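/- Let $N\ge 1$ and let $a_0,\dots,a_N$ be independent standard complex Gaussian random variables (density $\frac1\pi e^{-|z|^2}$ on $\mathbb{C}$). Let $$f_N(z)=\sum_{n=0}^{N} a_n\sqrt{\binom{N}{n}}\,z^n$$ be the spherical Gaussian analytic function, and let $x_1,\dots,x_N\in\mathbb{S}^2$ be its $N$ zeros in $\mathbb{C}\cup\{\infty\}$ (counted with multiplicity, a drop of the degree below $N$ being counted as zeros at $\infty$), lifted to the unit sphere by $z\mapsto \frac{1}{1+|z|^2}\left(2\operatorname{Re}z,\,2\operatorname{Im}z,\,|z|^2-1\right)$, $\infty\mapsto(0,0,1)$. Let $\ell\ge 0$ be an integer, $\tilde\lambda_\ell=\ell(\ell+1)$ and $m_\ell=2\ell+1$, and let $Y_\ell^m:\mathbb{S}^2\to\mathbb{R}$ ($m=1,\dots,m_\ell$) be eigenfunctions of the Laplacian $\Delta=-\operatorname{div}\nabla$ of $\mathbb{S}^2$ with eigenvalue $\tilde\lambda_\ell$, orthonormal in $L^2(\mathbb{S}^2)$ with respect to the normalized area measure (total mass $1$). Then each random variable $\sum_{n=1}^N Y_\ell^m(x_n)$ is square integrable and $$\sum_{m=1}^{m_\ell}\operatorname{Var}\left(\sum_{n=1}^N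 Y_\ell^m(x_n)\right)\le \frac{m_\ell\,\tilde\lambda_\ell^2}{N}\cdot\frac{\pi^2}{6}.$$ -/

import Mathlib

open MeasureTheory ProbabilityTheory

noncomputable section

namespace SphericalGAF

/-! ### The unit sphere `S²`, its normalized area and its Laplacian -/

/-- The unit sphere of Euclidean three-space. -/
abbrev S2 : Type := Metric.sphere (0 : EuclideanSpace ℝ (Fin 3)) 1

/-- The surface area measure of `S²`, normalized to total mass one. -/
def vol : Measure S2 :=
  ((volume : Measure (EuclideanSpace ℝ (Fin 3))).toSphere Set.univ)⁻¹ •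
    (volume : Measure (EuclideanSpace ℝ (Fin 3))).toSphere

theorem normalize_mem {y : EuclideanSpace ℝ (Fin 3)} (hy : y ≠ 0) :
    ‖y‖⁻¹ • y ∈ Metric.sphere (0 : EuclideanSpace ℝ (Fin 3)) 1 := by
  rw [mem_sphere_zero_iff_norm, norm_smul, norm_inv, norm_norm,
    inv_mul_cancel₀ (norm_ne_zero_iff.mpr hy)]

open Classical in
/-- The extension of a function on `S²` to `ℝ³ ∖ {0}` that is constant along rays,
`y ↦ Y (y / ‖y‖)` (with the irrelevant value `0` at the origin). -/
def radialExtension (Y : S2 → ℝ) (y : EuclideanSpace ℝ (Fin 3)) : ℝ :=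
  if hy : y = 0 then 0 else Y ⟨‖y‖⁻¹ • y, normalize_mem hy⟩

/-- The (positive) Laplace-Beltrami operator `-div ∇` of the round unit sphere: minus the Euclidean
Laplacian, at points of the sphere, of the extension that is constant along rays. -/
def sphereLaplacian (Y : S2 → ℝ) (x : S2) : ℝ :=
  -(Laplacian.laplacian (radialExtension Y) (x : EuclideanSpace ℝ (Fin 3)))

/-- `Y` is a (classical, `C²`) solution of `Δ Y = lam Y` on `S²`. -/
def IsEigenfunction (lam : ℝ) (Y : S2 → ℝ) : Prop :=
  ContDiffOn ℝ 2 (radialExtension Y) {0}ᶜ ∧ ∀ x : S2, sphereLaplacian Y x = lam * Y x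

/-- The family `Y` is orthonormal in `L²(S², vol)`. -/
def IsOrthonormal {ι : Type*} [DecidableEq ι] (Y : ι → S2 → ℝ) : Prop :=
  ∀ i j, ∫ x, Y i x * Y j x ∂vol = if i = j then 1 else 0

/-! ### Stereographic projection -/

theorem stereo_mem (z : ℂ) :
    (1 + ‖z‖ ^ 2)⁻¹ • !₂[2 * z.re, 2 * z.im, ‖z‖ ^ 2 - 1] ∈
      Metric.sphere (0 : EuclideanSpace ℝ (Fin 3)) 1 := by
  have h : (0 : ℝ) < 1 + ‖z‖ ^ 2 := by positivity
  have hz : ‖z‖ ^ 2 = z.re ^ 2 + z.im ^ 2 := by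
    rw [Complex.sq_norm, Complex.normSq_apply]; ring
  rw [mem_sphere_zero_iff_norm, EuclideanSpace.norm_eq, Real.sqrt_eq_one]
  simp only [Fin.sum_univ_three, PiLp.smul_apply, smul_eq_mul, Real.norm_eq_abs, sq_abs]
  simp only [Matrix.cons_val_zero, Matrix.cons_val_one, Matrix.cons_val]
  field_simp
  rw [hz]
  ring

/-- The inverse of the stereographic projection from the north pole onto the equatorial plane. -/
def stereo (z : ℂ) : S2 :=
  ⟨(1 + ‖z‖ ^ 2)⁻¹ • !₂[2 * z.re, 2 * z.im, ‖z‖ ^ 2 - 1], stereo_mem z⟩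

/-- The north pole, the point of `S²` that corresponds to `∞`. -/
def northPole : S2 :=
  ⟨EuclideanSpace.single 2 1, by simp⟩

/-! ### The spherical Gaussian analytic function and its zeros -/

/-- The standard complex Gaussian law: independent real and imaginary parts with law `N(0, 1/2)`. -/
def standardComplexGaussian : Measure ℂ :=
  ((gaussianReal 0 (1 / 2)).prod (gaussianReal 0 (1 / 2))).map
    (fun p : ℝ × ℝ => (⟨p.1, p.2⟩ : ℂ))

/-- The polynomial `f_N(z) = ∑_{n=0}^N a_n √(N choose n) zⁿ`. -/
def gaf (N : ℕ) (a : Fin (N + 1) → ℂ) : Polynomial ℂ :=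
  ∑ n : Fin (N + 1),
    Polynomial.monomial (n : ℕ) (a n * ((Real.sqrt (N.choose (n : ℕ)) : ℝ) : ℂ))

/-- The `N` zeros `x_1, …, x_N` on `S²`, with multiplicity, of `f_N` regarded as a function on
`ℂ ∪ {∞} ≅ S²`; a drop of the degree below `N` counts as zeros at `∞`. -/
def zerosOnSphere (N : ℕ) (a : Fin (N + 1) → ℂ) : Multiset S2 :=
  (gaf N a).roots.map stereo + Multiset.replicate (N - (gaf N a).natDegree) northPole

/-- The linear statistic `∑_{n=1}^N Y(x_n)` over the zeros. -/
def linearStatistic (N : ℕ) (Y : S2 → ℝ) (a : Fin (N + 1) → ℂ) : ℝ :=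
  ((zerosOnSphere N a).map Y).sum

end SphericalGAF

end

noncomputable section

namespace SphericalGAF

/-! ### Gaussian integrals -/

/-! Dividing `f_N(z)` by `(1 + |z|²)^(N/2)` gives a Gaussian function on the sphere which is
standard complex Gaussian at every point. The squared modulus of its covariance at `x, y` is `r =
((1 + ⟨x, y⟩) / 2) ^ N`, by the binomial theorem. Since `|z - w|` is the chordal distance up to
factors of `1 + |z|²` and `1 + |w|²`, the logarithm of its modulus is, almost everywhere and up to a
constant, the sum of `log ‖x - x_n‖` over the zeros.

The function `2 log ‖x - x₀‖` is a Green function of the sphere, so an eigenfunction satisfies `Y x₀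
= ∫ Y - 2 λ ∫ Y log ‖· - x₀‖` (`IsEigenfunction.eq_integral_sub`). Summing over the zeros turns the
linear statistic into `N ∫ Y - λ ∫ Y L`, where `L` is the centered logarithm of the squared modulus;
additive constants disappear because `λ ∫ Y = 0` (`IsEigenfunction.linearStatistic_eq`).

The variance is then at most `λ²` times the double integral of `Y(x) Y(y) E[L(x) L(y)]`. This
covariance is the dilogarithm `∑ r^k / k²`, of which only the bound `r π² / 6` is needed. It follows
by writing the logarithm as a Frullani integral of exponentials and computing the joint Laplace
transform of the two squared moduli (`abs_integral_log_mul_log_le`,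
`integral_exp_norm_sq_mul_exp_norm_sq`).

Finally `|Y(x) Y(y)| ≤ (Y(x)² + Y(y)²) / 2`, and `r` has average `1 / (N + 1)` in each variable, so
each normalized eigenfunction contributes at most `λ² π² / (6 (N + 1))`. No addition theorem for
spherical harmonics is used: the sum over `m` merely multiplies this by `2 l + 1`. -/

open Complex in
-- Variance `1/2` makes the density `e^(-x²) / √π`, so the total quadratic coefficient is `1 + u`.
-- The parameter `z` is complex so that one formula serves both characteristic functions (`z`
-- imaginary) and Laplace transforms (`z` real).
theorem integral_cexp_gaussianReal_half {u : ℝ} (hu : 0 ≤ u) (z : ℂ) :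
    ∫ x : ℝ, cexp (-u * x ^ 2 + z * x) ∂(gaussianReal 0 (1 / 2)) =
      ((Real.sqrt (1 + u))⁻¹ : ℝ) * cexp (z ^ 2 / (4 * (1 + u))) := by
  have h1 : (0 : ℝ) < 1 + u := by linarith
  have h1' : (1 + u : ℂ) ≠ 0 := by exact_mod_cast h1.ne'
  rw [integral_gaussianReal_eq_integral_smul (by norm_num)]
  have : ∀ x : ℝ, gaussianPDFReal 0 (1 / 2) x • cexp (-u * x ^ 2 + z * x) =
      ((Real.sqrt Real.pi)⁻¹ : ℝ) * cexp (-(1 + u) * x ^ 2 + z * x + 0) := by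
    intro x
    have hp : gaussianPDFReal 0 (1 / 2) x = (Real.sqrt Real.pi)⁻¹ * Real.exp (-x ^ 2) := by
      have h2 : ((1 / 2 : NNReal) : ℝ) = 1 / 2 := by norm_num
      rw [gaussianPDFReal_def]
      simp only [h2, sub_zero]
      congr 2
      · congr 1; ring
      · ring
    rw [hp, real_smul, ofReal_mul, mul_assoc, ofReal_exp, ← Complex.exp_add]
    congr 2
    push_cast; ring
  simp_rw [this]
  rw [integral_const_mul, integral_cexp_quadratic (by simp; linarith)]
  have e1 : (Real.pi / -(-(1 + u : ℂ))) ^ (1 / 2 : ℂ) =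
      ((Real.sqrt Real.pi / Real.sqrt (1 + u) : ℝ) : ℂ) := by
    rw [neg_neg, ← Real.sqrt_div Real.pi_pos.le, Real.sqrt_eq_rpow,
      ofReal_cpow (div_nonneg Real.pi_pos.le h1.le)]
    push_cast; rfl
  rw [e1, ← mul_assoc, ← ofReal_mul]
  congr 2
  · have : Real.sqrt Real.pi ≠ 0 := (Real.sqrt_pos.2 Real.pi_pos).ne'
    field_simp
  · field_simp; ring

theorem hasLaw_standardComplexGaussian :
    MeasurePreserving (fun p : ℝ × ℝ => (⟨p.1, p.2⟩ : ℂ))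
      ((gaussianReal 0 (1 / 2)).prod (gaussianReal 0 (1 / 2))) standardComplexGaussian :=
  ⟨Complex.measurableEquivRealProd.symm.measurable, rfl⟩

instance : IsProbabilityMeasure standardComplexGaussian :=
  Measure.isProbabilityMeasure_map hasLaw_standardComplexGaussian.measurable.aemeasurable

theorem integral_standardComplexGaussian (f : ℂ → ℂ) :
    ∫ z, f z ∂standardComplexGaussian =
      ∫ p : ℝ × ℝ, f ⟨p.1, p.2⟩ ∂((gaussianReal 0 (1 / 2)).prod (gaussianReal 0 (1 / 2))) :=
  (hasLaw_standardComplexGaussian.integral_comp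
    Complex.measurableEquivRealProd.symm.measurableEmbedding f).symm

open Complex in
theorem integral_cexp_standardComplexGaussian {u : ℝ} (hu : 0 ≤ u) (z w : ℂ) :
    ∫ h, cexp (-u * (‖h‖ ^ 2 : ℝ) + z * h.re + w * h.im) ∂standardComplexGaussian =
      ((1 + u)⁻¹ : ℝ) * cexp ((z ^ 2 + w ^ 2) / (4 * (1 + u))) := by
  have h1 : (0 : ℝ) < 1 + u := by linarith
  rw [integral_standardComplexGaussian]
  have : ∀ p : ℝ × ℝ, cexp (-u * (‖(⟨p.1, p.2⟩ : ℂ)‖ ^ 2 : ℝ) + z * p.1 + w * p.2) =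
      cexp (-u * p.1 ^ 2 + z * p.1) * cexp (-u * p.2 ^ 2 + w * p.2) := by
    intro p
    rw [Complex.sq_norm, normSq_apply, ← Complex.exp_add]
    push_cast; congr 1; ring
  simp_rw [this]
  rw [integral_prod_mul (fun x : ℝ => cexp (-u * x ^ 2 + z * x))
    (fun x : ℝ => cexp (-u * x ^ 2 + w * x)), integral_cexp_gaussianReal_half hu,
    integral_cexp_gaussianReal_half hu, mul_mul_mul_comm, ← Complex.exp_add, ← ofReal_mul,
    ← mul_inv, Real.mul_self_sqrt h1.le]
  congr 2
  ring

open Complex in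
theorem charFun_standardComplexGaussian (c : ℂ) :
    ∫ h, cexp (I * ((starRingEnd ℂ c * h).re : ℝ)) ∂standardComplexGaussian =
      (Real.exp (-‖c‖ ^ 2 / 4) : ℝ) := by
  have := integral_cexp_standardComplexGaussian le_rfl (I * c.re) (I * c.im)
  simp only [ofReal_zero, neg_zero, zero_mul, zero_add, add_zero, inv_one, ofReal_one,
    one_mul, mul_one] at this
  convert this using 2
  · ext h
    congr 1
    simp only [mul_re, conj_re, conj_im]; push_cast; ring
  · push_cast
    congr 1
    rw [mul_pow, mul_pow, I_sq, ← ofReal_pow ‖c‖, Complex.sq_norm, normSq_apply]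
    push_cast; ring

section GaussianVectors

variable {Ω : Type*} [MeasurableSpace Ω] {P : Measure Ω} {N : ℕ} {a : Fin (N + 1) → Ω → ℂ}

open Complex in
theorem integral_cexp_sum [IsProbabilityMeasure P]
    (ha_law : ∀ n, HasLaw (a n) standardComplexGaussian P) (ha_indep : iIndepFun a P)
    (W : Fin (N + 1) → ℂ) :
    ∫ ω, cexp (I * ((∑ n, starRingEnd ℂ (W n) * a n ω).re : ℝ)) ∂P =
      (Real.exp (-(∑ n, ‖W n‖ ^ 2) / 4) : ℝ) := by
  have hm : ∀ n, Continuous fun h : ℂ => cexp (I * ((starRingEnd ℂ (W n) * h).re : ℝ)) := by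
    intro n; fun_prop
  have := ha_indep.integral_fun_prod_comp (f := fun n h => cexp (I * ((starRingEnd ℂ (W n) * h).re : ℝ)))
    (fun n => (ha_law n).aemeasurable) (fun n => (hm n).aestronglyMeasurable)
  simp_rw [re_sum, ofReal_sum, Finset.mul_sum, Complex.exp_sum]
  rw [this, neg_div, Finset.sum_div, ← Finset.sum_neg_distrib, Real.exp_sum, ofReal_prod]
  refine Finset.prod_congr rfl fun n _ => ?_
  rw [← integral_map (ha_law n).aemeasurable (hm n).aestronglyMeasurable, (ha_law n).map_eq,
    charFun_standardComplexGaussian, neg_div]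

theorem aemeasurable_linearCombination
    (ha_law : ∀ n, HasLaw (a n) standardComplexGaussian P) (u : Fin (N + 1) → ℂ) :
    AEMeasurable (fun ω => ∑ n, a n ω * u n) P :=
  Finset.aemeasurable_fun_sum _ fun n _ => (ha_law n).aemeasurable.mul_const _

/-- A normalized linear combination of independent standard complex Gaussians is again one. -/
theorem hasLaw_linearCombination [IsProbabilityMeasure P]
    (ha_law : ∀ n, HasLaw (a n) standardComplexGaussian P) (ha_indep : iIndepFun a P)
    (u : Fin (N + 1) → ℂ) (hu : ∑ n, ‖u n‖ ^ 2 = 1) :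
    HasLaw (fun ω => ∑ n, a n ω * u n) standardComplexGaussian P := by
  have hm := aemeasurable_linearCombination ha_law u
  refine ⟨hm, ?_⟩
  have := Measure.isProbabilityMeasure_map hm
  refine Measure.ext_of_charFun ?_
  ext c
  have hc : ∀ h : ℂ, Complex.exp ((inner ℝ h c : ℝ) * Complex.I) =
      Complex.exp (Complex.I * ((starRingEnd ℂ c * h).re : ℝ)) := by
    intro h
    rw [Complex.inner, mul_comm]
    congr 3
    simp
  rw [charFun_apply, charFun_apply]
  simp_rw [hc]
  rw [charFun_standardComplexGaussian, integral_map hm (by fun_prop)]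
  -- The characteristic function at `c` pairs `a n` with the weight `conj (u n) * c`; these weights
  -- have total squared norm `‖c‖²`.
  have := integral_cexp_sum ha_law ha_indep (fun n => starRingEnd ℂ (u n) * c)
  convert this using 2
  · ext ω
    congr 4
    rw [Finset.mul_sum]
    refine Finset.sum_congr rfl fun n _ => ?_
    simp; ring
  · congr 2
    simp_rw [norm_mul, mul_pow, ← Finset.sum_mul, RCLike.norm_conj, hu, one_mul]

open Complex in
-- Read backwards, the characteristic function linearizes the square: an auxiliary Gaussian `g`
-- replaces `exp (-t |ζ|²)` by an average of exponentials linear in `ζ`, at the frequency `2 √t ζ`.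
theorem cexp_neg_norm_sq_eq_integral {t : ℝ} (ht : 0 ≤ t) (ζ : ℂ) :
    ((Real.exp (-t * ‖ζ‖ ^ 2) : ℝ) : ℂ) =
      ∫ g, cexp (I * ((starRingEnd ℂ ((2 * Real.sqrt t : ℝ) * ζ) * g).re : ℝ))
        ∂standardComplexGaussian := by
  rw [charFun_standardComplexGaussian, norm_mul, Complex.norm_real, Real.norm_eq_abs, mul_pow,
    sq_abs, mul_pow, Real.sq_sqrt ht]
  congr 2; ring

open Complex in
-- After linearizing both squares with independent Gaussians `g` and `h`, Fubini lets the `a n` be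
-- integrated first, which leaves a Gaussian integral in `(g, h)` coupled only through `κ`.
-- Integrating out `h` and then `g` gives the determinant `(1 + t)(1 + s) - r t s`.
theorem integral_exp_norm_sq_mul_exp_norm_sq [IsProbabilityMeasure P]
    (ha_law : ∀ n, HasLaw (a n) standardComplexGaussian P) (ha_indep : iIndepFun a P)
    {u v : Fin (N + 1) → ℂ} (hu : ∑ n, ‖u n‖ ^ 2 = 1) (hv : ∑ n, ‖v n‖ ^ 2 = 1)
    {r : ℝ} (hr : ‖∑ n, starRingEnd ℂ (u n) * v n‖ ^ 2 = r) (hr1 : r ≤ 1)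
    {t s : ℝ} (ht : 0 ≤ t) (hs : 0 ≤ s) :
    ∫ ω, Real.exp (-t * ‖∑ n, a n ω * u n‖ ^ 2) * Real.exp (-s * ‖∑ n, a n ω * v n‖ ^ 2) ∂P =
      ((1 + t) * (1 + s) - r * t * s)⁻¹ := by
  set κ := ∑ n, starRingEnd ℂ (u n) * v n with hκ
  have hmu := aemeasurable_linearCombination ha_law u
  have hmv := aemeasurable_linearCombination ha_law v
  have hW : ∀ g h : ℂ, ∑ n, ‖(2 * Real.sqrt t : ℝ) * g * starRingEnd ℂ (u n) +
      (2 * Real.sqrt s : ℝ) * h * starRingEnd ℂ (v n)‖ ^ 2 =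
      4 * (t * ‖g‖ ^ 2 + s * ‖h‖ ^ 2 + 2 * Real.sqrt t * Real.sqrt s *
        ((g * κ) * starRingEnd ℂ h).re) := by
    intro g h
    have e : ∀ n, ‖(2 * Real.sqrt t : ℝ) * g * starRingEnd ℂ (u n) +
      (2 * Real.sqrt s : ℝ) * h * starRingEnd ℂ (v n)‖ ^ 2 =
      4 * t * ‖g‖ ^ 2 * ‖u n‖ ^ 2 + 4 * s * ‖h‖ ^ 2 * ‖v n‖ ^ 2 +
      8 * Real.sqrt t * Real.sqrt s * (g * (starRingEnd ℂ (u n) * v n) * starRingEnd ℂ h).re := by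
      intro n
      have h1 := Real.sq_sqrt ht
      have h2 := Real.sq_sqrt hs
      simp only [Complex.sq_norm, normSq_apply, add_re, add_im, mul_re, mul_im, conj_re, conj_im,
        ofReal_re, ofReal_im]
      generalize Real.sqrt t = p at *
      generalize Real.sqrt s = q at *
      subst h1 h2
      ring
    simp_rw [e, Finset.sum_add_distrib, ← Finset.mul_sum, hu, hv]
    rw [← re_sum, ← Finset.sum_mul, ← Finset.mul_sum]
    ring
  -- This is the coefficient of `-|g|²` left after `h` is integrated out; its sign is where `r ≤ 1`
  -- enters.
  have hκ0 : 0 ≤ t - t * s * r / (1 + s) := by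
    rw [sub_nonneg, div_le_iff₀ (by linarith)]
    nlinarith [mul_nonneg ht hs]
  have key : ∀ g h : ℂ,
      ∫ ω, cexp (I * ((starRingEnd ℂ ((2 * Real.sqrt t : ℝ) * ∑ n, a n ω * u n) * g).re : ℝ)) *
        cexp (I * ((starRingEnd ℂ ((2 * Real.sqrt s : ℝ) * ∑ n, a n ω * v n) * h).re : ℝ)) ∂P =
      (Real.exp (-t * ‖g‖ ^ 2) : ℝ) * cexp (-s * (‖h‖ ^ 2 : ℝ) +
        (-(2 * Real.sqrt t * Real.sqrt s * (g * κ).re : ℝ)) * h.re +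
        (-(2 * Real.sqrt t * Real.sqrt s * (g * κ).im : ℝ)) * h.im) := by
    intro g h
    have := integral_cexp_sum ha_law ha_indep (fun n =>
      (2 * Real.sqrt t : ℝ) * g * starRingEnd ℂ (u n) +
      (2 * Real.sqrt s : ℝ) * h * starRingEnd ℂ (v n))
    rw [hW] at this
    refine Eq.trans ?_ (this.trans ?_)
    · refine integral_congr_ae (Filter.Eventually.of_forall fun ω => ?_)
      simp only
      rw [← Complex.exp_add, ← mul_add, ← ofReal_add, ← add_re]
      congr 3
      rw [← conj_re]
      congr 1
      simp only [map_add, map_mul, map_sum, conj_conj, Finset.mul_sum, Finset.sum_mul,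
        ← Finset.sum_add_distrib, conj_ofReal]
      refine Finset.sum_congr rfl fun n _ => ?_
      ring
    · rw [ofReal_exp, ofReal_exp, ← Complex.exp_add]
      congr 1
      rw [mul_re _ (starRingEnd ℂ h), conj_re, conj_im]
      push_cast; ring
  have hint : Integrable (Function.uncurry fun (ω : Ω) (q : ℂ × ℂ) =>
      cexp (I * ((starRingEnd ℂ ((2 * Real.sqrt t : ℝ) * ∑ n, a n ω * u n) * q.1).re : ℝ)) *
        cexp (I * ((starRingEnd ℂ ((2 * Real.sqrt s : ℝ) * ∑ n, a n ω * v n) * q.2).re : ℝ)))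
      (P.prod (standardComplexGaussian.prod standardComplexGaussian)) := by
    have h1 : AEMeasurable (fun q : Ω × ℂ × ℂ => ∑ n, a n q.1 * u n)
        (P.prod (standardComplexGaussian.prod standardComplexGaussian)) :=
      hmu.comp_quasiMeasurePreserving Measure.quasiMeasurePreserving_fst
    have h2 : AEMeasurable (fun q : Ω × ℂ × ℂ => ∑ n, a n q.1 * v n)
        (P.prod (standardComplexGaussian.prod standardComplexGaussian)) :=
      hmv.comp_quasiMeasurePreserving Measure.quasiMeasurePreserving_fst
    have hc : Continuous fun w : (ℂ × ℂ) × (ℂ × ℂ) =>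
        cexp (I * ((starRingEnd ℂ ((2 * Real.sqrt t : ℝ) * w.1.1) * w.2.1).re : ℝ)) *
        cexp (I * ((starRingEnd ℂ ((2 * Real.sqrt s : ℝ) * w.1.2) * w.2.2).re : ℝ)) := by
      fun_prop
    have h3 := hc.measurable.comp_aemeasurable ((h1.prodMk h2).prodMk
      (measurable_snd (α := Ω) (β := ℂ × ℂ)).aemeasurable)
    refine Integrable.of_bound h3.aestronglyMeasurable 1 (Filter.Eventually.of_forall fun q => ?_)
    rw [Function.uncurry_def]
    rw [norm_mul, mul_comm I, mul_comm I, norm_exp_ofReal_mul_I, norm_exp_ofReal_mul_I, mul_one]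
  have hG : Integrable (fun q : ℂ × ℂ => (Real.exp (-t * ‖q.1‖ ^ 2) : ℝ) *
      cexp (-s * (‖q.2‖ ^ 2 : ℝ) +
        (-(2 * Real.sqrt t * Real.sqrt s * (q.1 * κ).re : ℝ)) * q.2.re +
        (-(2 * Real.sqrt t * Real.sqrt s * (q.1 * κ).im : ℝ)) * q.2.im))
      (standardComplexGaussian.prod standardComplexGaussian) := by
    -- Integrability in `(g, h)` is inherited through Fubini from the unimodular integrand, with no
    -- estimate of the explicit formula.
    refine hint.integral_prod_right.congr (Filter.Eventually.of_forall fun q => ?_)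
    exact key q.1 q.2
  rw [← ofReal_inj, ← integral_complex_ofReal]
  simp_rw [ofReal_mul, cexp_neg_norm_sq_eq_integral ht, cexp_neg_norm_sq_eq_integral hs,
    ← integral_prod_mul]
  rw [integral_integral_swap hint]
  simp_rw [key]
  rw [integral_prod _ hG]
  simp_rw [integral_const_mul]
  have hs' : (1 + s : ℝ) ≠ 0 := by linarith
  have inner : ∀ g : ℂ, ((Real.exp (-t * ‖g‖ ^ 2) : ℝ) : ℂ) *
      ∫ h, cexp (-s * (‖h‖ ^ 2 : ℝ) +
        (-(2 * Real.sqrt t * Real.sqrt s * (g * κ).re : ℝ)) * h.re +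
        (-(2 * Real.sqrt t * Real.sqrt s * (g * κ).im : ℝ)) * h.im) ∂standardComplexGaussian =
      ((1 + s)⁻¹ : ℝ) * cexp (-(t - t * s * r / (1 + s) : ℝ) * (‖g‖ ^ 2 : ℝ) + 0 * g.re +
        0 * g.im) := by
    intro g
    rw [integral_cexp_standardComplexGaussian hs, mul_left_comm, ofReal_exp, ← Complex.exp_add]
    congr 2
    have : (2 * Real.sqrt t * Real.sqrt s * (g * κ).re) ^ 2 +
        (2 * Real.sqrt t * Real.sqrt s * (g * κ).im) ^ 2 = 4 * (t * s * r * ‖g‖ ^ 2) := by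
      have h1 : ‖g * κ‖ ^ 2 = r * ‖g‖ ^ 2 := by rw [norm_mul, mul_pow, hr, mul_comm]
      rw [Complex.sq_norm, normSq_apply] at h1
      rw [mul_pow, mul_pow, mul_pow, mul_pow, mul_pow, mul_pow, Real.sq_sqrt ht, Real.sq_sqrt hs]
      linear_combination 4 * t * s * h1
    rw [neg_sq, neg_sq, ← ofReal_pow, ← ofReal_pow, ← ofReal_add, this]
    have : (1 + s : ℂ) ≠ 0 := by exact_mod_cast hs'
    push_cast
    field_simp
    ring
  simp_rw [inner, integral_const_mul]
  rw [integral_cexp_standardComplexGaussian hκ0]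
  norm_num
  rw [← mul_inv]
  congr 1
  have : (1 + s : ℂ) ≠ 0 := by exact_mod_cast hs'
  field_simp
  ring

/-! ### Density and logarithmic moments of the complex Gaussian -/

theorem standardComplexGaussian_eq_withDensity :
    standardComplexGaussian = (volume : Measure ℂ).withDensity
      (fun z => ENNReal.ofReal (Real.pi⁻¹ * Real.exp (-‖z‖ ^ 2))) := by
  have hv := Complex.volume_preserving_equiv_real_prod.symm
  have hm : Measurable fun z : ℂ => ENNReal.ofReal (Real.pi⁻¹ * Real.exp (-‖z‖ ^ 2)) := by fun_prop
  refine Measure.ext_of_lintegral _ fun f hf => ?_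
  have h2 : ((1 / 2 : NNReal) : ℝ) = 1 / 2 := by norm_num
  rw [← hasLaw_standardComplexGaussian.lintegral_comp hf, gaussianReal_of_var_ne_zero _ (by norm_num),
    prod_withDensity (measurable_gaussianPDF _ _) (measurable_gaussianPDF _ _),
    lintegral_withDensity_eq_lintegral_mul (g := fun p : ℝ × ℝ => f ⟨p.1, p.2⟩) _ (by fun_prop)
      (hf.comp hasLaw_standardComplexGaussian.measurable),
    lintegral_withDensity_eq_lintegral_mul _ hm hf, ← hv.lintegral_comp (hm.mul hf)]
  refine lintegral_congr fun p => ?_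
  simp only [Pi.mul_apply]
  congr 1
  simp only [gaussianPDF, gaussianPDFReal, h2, sub_zero]
  rw [← ENNReal.ofReal_mul (by positivity), mul_mul_mul_comm, ← Real.exp_add, ← mul_inv,
    Real.mul_self_sqrt (by positivity), Complex.sq_norm, Complex.normSq_apply]
  congr 3
  · ring
  · simp [Complex.measurableEquivRealProd]; ring

theorem log_sq_le {x : ℝ} (hx : 0 ≤ x) : Real.log x ^ 2 ≤ 2 * (x ^ (1 : ℝ) + x ^ (-1 : ℝ)) := by
  rcases hx.eq_or_lt with rfl | hx
  · simp
  have hq : ∀ y : ℝ, 0 ≤ y → y ^ 2 ≤ 2 * Real.exp y := fun y hy => by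
    have := Real.quadratic_le_exp_of_nonneg hy
    nlinarith
  rw [Real.rpow_one, Real.rpow_neg_one]
  have hx' : 0 < x⁻¹ := inv_pos.2 hx
  rcases le_total 0 (Real.log x) with h | h
  · have := hq _ h
    rw [Real.exp_log hx] at this
    linarith
  · have := hq _ (neg_nonneg.2 h)
    rw [Real.exp_neg, Real.exp_log hx, neg_sq] at this
    linarith

theorem integrable_log_sq_standardComplexGaussian :
    Integrable (fun z : ℂ => Real.log (‖z‖ ^ 2) ^ 2) standardComplexGaussian := by
  have hi : ∀ q : ℝ, -2 < q →
      Integrable (fun z : ℂ => ‖z‖ ^ q * Real.exp (-‖z‖ ^ (2 : ℝ))) := by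
    intro q hq
    -- The Bochner integral of a non-integrable function is `0`, so the positive closed form in
    -- terms of `Γ` already proves integrability. The condition `-2 < q` is integrability at the
    -- origin of the plane.
    refine Integrable.of_integral_ne_zero ?_
    rw [Complex.integral_rpow_mul_exp_neg_rpow (by norm_num) hq]
    have : 0 < Real.Gamma ((q + 2) / 2) := Real.Gamma_pos_of_pos (by linarith)
    positivity
  rw [standardComplexGaussian_eq_withDensity,
    integrable_withDensity_iff (by fun_prop) (by simp)]
  have hb := ((hi 1 (by norm_num)).add (hi (-1) (by norm_num))).const_mul (8 * Real.pi⁻¹)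
  refine hb.mono' (Measurable.aestronglyMeasurable (by fun_prop))
    (Filter.Eventually.of_forall fun z => ?_)
  rw [ENNReal.toReal_ofReal (by positivity), Real.log_pow, Real.norm_of_nonneg (by positivity)]
  have := log_sq_le (norm_nonneg z)
  simp only [Pi.add_apply]
  have h2 : ‖z‖ ^ (2 : ℝ) = ‖z‖ ^ 2 := by norm_cast
  rw [h2]
  have hE : 0 ≤ Real.pi⁻¹ * Real.exp (-‖z‖ ^ 2) := by positivity
  calc _ = 4 * Real.log ‖z‖ ^ 2 * (Real.pi⁻¹ * Real.exp (-‖z‖ ^ 2)) := by push_cast; ring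
    _ ≤ 4 * (2 * (‖z‖ ^ (1 : ℝ) + ‖z‖ ^ (-1 : ℝ))) * (Real.pi⁻¹ * Real.exp (-‖z‖ ^ 2)) := by
      gcongr
    _ = _ := by ring

end GaussianVectors

/-! ### The covariance of logarithms -/

/-- The tangent-line bound `1 - e^(-x) ≤ x` cancels the singularity `t⁻¹` at zero and leaves an
integrable exponential when `a > 0`. -/
theorem inv_mul_exp_sub_exp_le {a b t : ℝ} (ht : 0 < t) :
    t⁻¹ * (Real.exp (-t * a) - Real.exp (-t * b)) ≤ (b - a) * Real.exp (-a * t) := by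
  have h1 : Real.exp (-t * b) = Real.exp (-a * t) * Real.exp (-(t * (b - a))) := by
    rw [← Real.exp_add]; ring_nf
  have h2 : Real.exp (-t * a) = Real.exp (-a * t) := by ring_nf
  have h3 := Real.add_one_le_exp (-(t * (b - a)))
  rw [inv_mul_le_iff₀ ht, h1, h2]
  nlinarith [Real.exp_pos (-a * t)]

theorem integrableOn_frullani_exp_of_le {a b : ℝ} (ha : 0 < a) (hab : a ≤ b) :
    IntegrableOn (fun t : ℝ => t⁻¹ * (Real.exp (-t * a) - Real.exp (-t * b))) (Set.Ioi 0) := by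
  refine ((integrableOn_exp_mul_Ioi (neg_lt_zero.2 ha) 0).const_mul (b - a)).mono'
    (Measurable.aestronglyMeasurable (by fun_prop)) ?_
  refine (ae_restrict_mem measurableSet_Ioi).mono fun t (ht : 0 < t) => ?_
  rw [Real.norm_of_nonneg]
  · exact inv_mul_exp_sub_exp_le ht
  · refine mul_nonneg (by positivity) (sub_nonneg.2 (Real.exp_le_exp.2 ?_))
    nlinarith

theorem integrableOn_frullani_exp {s : ℝ} (hs : 0 < s) :
    IntegrableOn (fun t : ℝ => t⁻¹ * (Real.exp (-t) - Real.exp (-t * s))) (Set.Ioi 0) := by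
  rcases le_total 1 s with h | h
  · simpa using integrableOn_frullani_exp_of_le one_pos h
  · have := (integrableOn_frullani_exp_of_le hs h).neg
    refine this.congr_fun (fun t _ => ?_) measurableSet_Ioi
    simp only [Pi.neg_apply, mul_one]; ring

theorem integral_frullani_exp {s : ℝ} (hs : 0 < s) :
    ∫ t in Set.Ioi (0 : ℝ), t⁻¹ * (Real.exp (-t) - Real.exp (-t * s)) = Real.log s := by
  have hc : Continuous fun t : ℝ => Real.exp (-t) := by fun_prop
  have := Frullani.integral_Ioi_eq (f := fun t : ℝ => Real.exp (-t)) (L := 1) (R := 0)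
    (hc.locallyIntegrable.locallyIntegrableOn _) one_pos hs
    (by simpa using (hc.tendsto 0).mono_left nhdsWithin_le_nhds)
    (Real.tendsto_exp_neg_atTop_nhds_zero)
    (by simpa [mul_comm] using integrableOn_frullani_exp hs)
  simpa [mul_comm s] using this

/-- The Frullani integrand has constant sign, that of `log s`, so taking absolute values loses
nothing. This provides the domination needed for Fubini. -/
theorem integral_abs_frullani_exp {s : ℝ} (hs : 0 < s) :
    ∫ t in Set.Ioi (0 : ℝ), |t⁻¹ * (Real.exp (-t) - Real.exp (-t * s))| = |Real.log s| := by
  rw [← integral_frullani_exp hs]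
  rcases le_total 1 s with h | h
  · have hp : ∀ t ∈ Set.Ioi (0 : ℝ), 0 ≤ t⁻¹ * (Real.exp (-t) - Real.exp (-t * s)) := by
      intro t (ht : 0 < t)
      refine mul_nonneg (by positivity) (sub_nonneg.2 (Real.exp_le_exp.2 ?_))
      nlinarith
    rw [abs_of_nonneg (setIntegral_nonneg measurableSet_Ioi hp)]
    exact setIntegral_congr_fun measurableSet_Ioi fun t ht => abs_of_nonneg (hp t ht)
  · have hp : ∀ t ∈ Set.Ioi (0 : ℝ), t⁻¹ * (Real.exp (-t) - Real.exp (-t * s)) ≤ 0 := by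
      intro t (ht : 0 < t)
      refine mul_nonpos_of_nonneg_of_nonpos (by positivity) (sub_nonpos.2 (Real.exp_le_exp.2 ?_))
      nlinarith
    rw [abs_of_nonpos (setIntegral_nonpos measurableSet_Ioi hp), ← integral_neg]
    exact setIntegral_congr_fun measurableSet_Ioi fun t ht => abs_of_nonpos (hp t ht)

theorem inv_one_add_sub_exp_nonneg {t : ℝ} (ht : 0 < t) :
    0 ≤ t⁻¹ * ((1 + t)⁻¹ - Real.exp (-t)) := by
  refine mul_nonneg (by positivity) (sub_nonneg.2 ?_)
  rw [Real.exp_neg]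
  refine inv_anti₀ (by positivity) ?_
  linarith [Real.add_one_le_exp t]

theorem integrableOn_inv_one_add_sub_exp :
    IntegrableOn (fun t : ℝ => t⁻¹ * ((1 + t)⁻¹ - Real.exp (-t))) (Set.Ioi 0) := by
  have hm : Measurable (fun t : ℝ => t⁻¹ * ((1 + t)⁻¹ - Real.exp (-t))) := by fun_prop
  rw [← Set.Ioc_union_Ioi_eq_Ioi (zero_le_one' ℝ)]
  refine IntegrableOn.union ?_ ?_
  · refine IntegrableOn.of_bound (by simp) hm.aestronglyMeasurable 1
      ((ae_restrict_mem measurableSet_Ioc).mono fun t ht => ?_)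
    have ht0 : 0 < t := ht.1
    rw [Real.norm_of_nonneg (inv_one_add_sub_exp_nonneg ht0), inv_mul_le_iff₀ ht0]
    have h1 := Real.add_one_le_exp (-t)
    have h2 : (1 + t)⁻¹ ≤ 1 := inv_le_one_of_one_le₀ (by linarith)
    linarith
  · refine (integrableOn_Ioi_rpow_of_lt (by norm_num : (-2 : ℝ) < -1) one_pos).mono'
      hm.aestronglyMeasurable ((ae_restrict_mem measurableSet_Ioi).mono fun t (ht : 1 < t) => ?_)
    have ht0 : 0 < t := one_pos.trans ht
    rw [Real.norm_of_nonneg (inv_one_add_sub_exp_nonneg ht0), Real.rpow_neg ht0.le,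
      inv_mul_le_iff₀ ht0, Real.rpow_two]
    have h1 := Real.exp_pos (-t)
    have h2 : (1 + t)⁻¹ ≤ t⁻¹ := inv_anti₀ ht0 (by linarith)
    have h3 : t * (t ^ 2)⁻¹ = t⁻¹ := by field_simp
    linarith

/-- The constant `∫₀^∞ ((1 + t)⁻¹ - e⁻ᵗ) / t dt` (Euler's constant), minus the mean of
`log |ζ|²` for a standard complex Gaussian `ζ`. -/
def logCenter : ℝ := ∫ t in Set.Ioi (0 : ℝ), t⁻¹ * ((1 + t)⁻¹ - Real.exp (-t))

/-- The integrand in the representation of `log s + logCenter`. -/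
def logKernel (s t : ℝ) : ℝ := t⁻¹ * ((1 + t)⁻¹ - Real.exp (-t * s))

theorem logKernel_eq (s t : ℝ) : logKernel s t =
    t⁻¹ * ((1 + t)⁻¹ - Real.exp (-t)) + t⁻¹ * (Real.exp (-t) - Real.exp (-t * s)) := by
  rw [logKernel]; ring

theorem integrableOn_logKernel {s : ℝ} (hs : 0 < s) :
    IntegrableOn (logKernel s) (Set.Ioi 0) := by
  rw [funext (logKernel_eq s)]
  exact integrableOn_inv_one_add_sub_exp.add (integrableOn_frullani_exp hs)

theorem integral_logKernel {s : ℝ} (hs : 0 < s) :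
    ∫ t in Set.Ioi (0 : ℝ), logKernel s t = Real.log s + logCenter := by
  simp_rw [logKernel_eq]
  rw [integral_add integrableOn_inv_one_add_sub_exp (integrableOn_frullani_exp hs),
    integral_frullani_exp hs, logCenter, add_comm]

theorem integral_norm_logKernel_le {s : ℝ} (hs : 0 < s) :
    ∫ t in Set.Ioi (0 : ℝ), ‖logKernel s t‖ ≤ |Real.log s| + logCenter := by
  have h1 := integrableOn_inv_one_add_sub_exp
  have h2 := (integrableOn_frullani_exp hs).abs
  rw [← integral_abs_frullani_exp hs, logCenter, add_comm, ← integral_add h1 h2]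
  refine setIntegral_mono_on (integrableOn_logKernel hs).norm (h1.add h2) measurableSet_Ioi
    fun t ht => ?_
  rw [logKernel_eq, Real.norm_eq_abs]
  refine (abs_add_le _ _).trans ?_
  rw [abs_of_nonneg (inv_one_add_sub_exp_nonneg ht)]

/-! ### The double integral that produces `π² / 6` -/

theorem lintegral_pow_div_one_add_pow (k : ℕ) :
    ∫⁻ t in Set.Ioi (0 : ℝ), ENNReal.ofReal (t ^ k / (1 + t) ^ (k + 2)) =
      ENNReal.ofReal (1 / (k + 1)) := by
  -- The antiderivative is a power of `t / (1 + t)`, whose derivative is `1 / (1 + t)²`.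
  have hd : ∀ t ∈ Set.Ici (0 : ℝ), HasDerivAt (fun t : ℝ => (t / (1 + t)) ^ (k + 1) / (k + 1))
      (t ^ k / (1 + t) ^ (k + 2)) t := by
    intro t (ht : 0 ≤ t)
    have h1 : (1 + t) ≠ 0 := by positivity
    have := ((((hasDerivAt_id t).div ((hasDerivAt_id t).const_add 1) h1).pow (k + 1)).div_const
      ((k : ℝ) + 1))
    refine this.congr_deriv ?_
    simp only [id, Nat.add_sub_cancel, Pi.div_apply, div_pow]
    have : (k : ℝ) + 1 ≠ 0 := by positivity
    push_cast
    field_simp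
    ring
  have hpos : ∀ t ∈ Set.Ioi (0 : ℝ), 0 ≤ t ^ k / (1 + t) ^ (k + 2) := by
    intro t (ht : 0 < t); positivity
  have hl : Filter.Tendsto (fun t : ℝ => (t / (1 + t)) ^ (k + 1) / ((k : ℝ) + 1)) Filter.atTop
      (nhds (1 / (k + 1))) := by
    have h0 : Filter.Tendsto (fun t : ℝ => t / (1 + t)) Filter.atTop (nhds 1) := by
      have h1 : Filter.Tendsto (fun t : ℝ => 1 - (1 + t)⁻¹) Filter.atTop (nhds (1 - 0)) :=
        tendsto_const_nhds.sub (tendsto_inv_atTop_zero.comp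
          (Filter.tendsto_atTop_add_const_left _ 1 Filter.tendsto_id))
      rw [sub_zero] at h1
      refine h1.congr' ((Filter.eventually_gt_atTop 0).mono fun t ht => ?_)
      field_simp
      ring
    simpa using (h0.pow (k + 1)).div_const ((k : ℝ) + 1)
  rw [← ofReal_integral_eq_lintegral_ofReal (integrableOn_Ioi_deriv_of_nonneg' hd hpos hl)
    ((ae_restrict_mem measurableSet_Ioi).mono hpos),
    integral_Ioi_of_hasDerivAt_of_nonneg' hd hpos hl]
  simp

/-- Expanding the kernel as a geometric series in `p.1 p.2 / ((1 + p.1)(1 + p.2))` separates the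
variables; each term is the square of a one-variable integral `1 / (k + 1)`, and the sum is `ζ(2)`.
Working with `lintegral` makes the interchange of sum and integral automatic. -/
theorem lintegral_dilog_kernel :
    ∫⁻ p : ℝ × ℝ, ENNReal.ofReal
        (((1 + p.1) * (1 + p.2)) * ((1 + p.1) * (1 + p.2) - p.1 * p.2))⁻¹
        ∂((volume.restrict (Set.Ioi 0)).prod (volume.restrict (Set.Ioi 0))) =
      ENNReal.ofReal (Real.pi ^ 2 / 6) := by
  have hae : ∀ᵐ p : ℝ × ℝ ∂((volume.restrict (Set.Ioi (0 : ℝ))).prod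
      (volume.restrict (Set.Ioi (0 : ℝ)))), 0 < p.1 ∧ 0 < p.2 := by
    rw [Measure.prod_restrict]
    exact ae_restrict_mem (measurableSet_Ioi.prod measurableSet_Ioi)
  have hz := hasSum_zeta_two
  -- The series for `ζ(2)` starts at `n = 0` with the conventional term `1 / 0 = 0`, which is
  -- dropped.
  rw [hasSum_nat_add_iff' 1 |>.symm] at hz
  simp only [Finset.range_one, Finset.sum_singleton, Nat.cast_zero, ne_eq, OfNat.ofNat_ne_zero,
    not_false_eq_true, zero_pow, div_zero, sub_zero] at hz
  rw [← hz.tsum_eq, ENNReal.ofReal_tsum_of_nonneg (fun n => by positivity) hz.summable]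
  have hexp : ∀ k : ℕ, ENNReal.ofReal (1 / ((k + 1 : ℕ) : ℝ) ^ 2) =
      ∫⁻ p : ℝ × ℝ, ENNReal.ofReal (p.1 ^ k / (1 + p.1) ^ (k + 2)) *
        ENNReal.ofReal (p.2 ^ k / (1 + p.2) ^ (k + 2))
        ∂((volume.restrict (Set.Ioi 0)).prod (volume.restrict (Set.Ioi 0))) := by
    intro k
    rw [lintegral_prod_mul (f := fun t : ℝ => ENNReal.ofReal (t ^ k / (1 + t) ^ (k + 2)))
      (g := fun t : ℝ => ENNReal.ofReal (t ^ k / (1 + t) ^ (k + 2)))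
      (Measurable.aemeasurable (by fun_prop)) (Measurable.aemeasurable (by fun_prop)),
      lintegral_pow_div_one_add_pow, ← ENNReal.ofReal_mul (by positivity)]
    congr 1
    push_cast
    field_simp
  simp_rw [hexp]
  rw [← lintegral_tsum (fun k => Measurable.aemeasurable (by fun_prop))]
  refine lintegral_congr_ae (hae.mono fun p hp => ?_)
  obtain ⟨h1, h2⟩ := hp
  have hA : 0 < (1 + p.1) * (1 + p.2) := by positivity
  have hlt : p.1 * p.2 < (1 + p.1) * (1 + p.2) := by nlinarith
  have hg : HasSum (fun k : ℕ => (p.1 ^ k / (1 + p.1) ^ (k + 2)) * (p.2 ^ k / (1 + p.2) ^ (k + 2)))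
      (((1 + p.1) * (1 + p.2)) * ((1 + p.1) * (1 + p.2) - p.1 * p.2))⁻¹ := by
    have := (hasSum_geometric_of_lt_one (r := p.1 * p.2 / ((1 + p.1) * (1 + p.2))) (by positivity)
      ((div_lt_one hA).2 hlt)).mul_left (((1 + p.1) * (1 + p.2)) ^ 2)⁻¹
    have e1 : (((1 + p.1) * (1 + p.2)) ^ 2)⁻¹ * (1 - p.1 * p.2 / ((1 + p.1) * (1 + p.2)))⁻¹ =
        (((1 + p.1) * (1 + p.2)) * ((1 + p.1) * (1 + p.2) - p.1 * p.2))⁻¹ := by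
      rw [← mul_inv]
      congr 1
      field_simp
    rw [e1] at this
    refine Eq.mpr (congrArg (fun f : ℕ → ℝ => HasSum f _) (funext fun k => ?_)) this
    simp only [div_pow, mul_pow, pow_add]
    field_simp
  simp only
  rw [← hg.tsum_eq, ENNReal.ofReal_tsum_of_nonneg (fun n => by positivity) hg.summable]
  congr 1
  ext k
  rw [ENNReal.ofReal_mul (by positivity)]

/-- Each centered logarithm is `∫ logKernel dt`, so the covariance is a double integral of
`E[logKernel (S) logKernel (T)]`. That expectation is the joint Laplace transform minus the product
of the marginal ones, divided by `t u`. The difference carries a factor `r t u`: the `t u` cancels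
and `r` comes out of the integral. Setting `r = 1` in what remains only enlarges it, to the kernel
with integral `π² / 6`. -/
theorem abs_integral_log_mul_log_le {Ω : Type*} [MeasurableSpace Ω] {P : Measure Ω}
    [IsProbabilityMeasure P] {S T : Ω → ℝ} (hS : AEMeasurable S P) (hT : AEMeasurable T P)
    (hS0 : ∀ᵐ ω ∂P, 0 < S ω) (hT0 : ∀ᵐ ω ∂P, 0 < T ω)
    (hS2 : MemLp (fun ω => Real.log (S ω)) 2 P) (hT2 : MemLp (fun ω => Real.log (T ω)) 2 P)
    {r : ℝ} (hr0 : 0 ≤ r) (hr1 : r ≤ 1)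
    (hLS : ∀ t, 0 ≤ t → ∫ ω, Real.exp (-t * S ω) ∂P = (1 + t)⁻¹)
    (hLT : ∀ t, 0 ≤ t → ∫ ω, Real.exp (-t * T ω) ∂P = (1 + t)⁻¹)
    (hL : ∀ t u, 0 ≤ t → 0 ≤ u → ∫ ω, Real.exp (-t * S ω) * Real.exp (-u * T ω) ∂P =
      ((1 + t) * (1 + u) - r * t * u)⁻¹) :
    |∫ ω, (Real.log (S ω) + logCenter) * (Real.log (T ω) + logCenter) ∂P| ≤
      r * (Real.pi ^ 2 / 6) := by
  set ν := (volume.restrict (Set.Ioi (0 : ℝ))) with hν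
  have hae : ∀ᵐ p : ℝ × ℝ ∂(ν.prod ν), 0 < p.1 ∧ 0 < p.2 := by
    rw [hν, Measure.prod_restrict]
    exact ae_restrict_mem (measurableSet_Ioi.prod measurableSet_Ioi)
  have hker : Measurable (Function.uncurry logKernel) := by
    unfold logKernel Function.uncurry
    fun_prop
  have hint : Integrable (Function.uncurry fun (ω : Ω) (p : ℝ × ℝ) =>
      logKernel (S ω) p.1 * logKernel (T ω) p.2) (P.prod (ν.prod ν)) := by
    have hmeas : AEStronglyMeasurable (Function.uncurry fun (ω : Ω) (p : ℝ × ℝ) =>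
        logKernel (S ω) p.1 * logKernel (T ω) p.2) (P.prod (ν.prod ν)) := by
      have h1 : AEMeasurable (fun q : Ω × ℝ × ℝ => S q.1) (P.prod (ν.prod ν)) :=
        hS.comp_quasiMeasurePreserving Measure.quasiMeasurePreserving_fst
      have h2 : AEMeasurable (fun q : Ω × ℝ × ℝ => T q.1) (P.prod (ν.prod ν)) :=
        hT.comp_quasiMeasurePreserving Measure.quasiMeasurePreserving_fst
      have e1 := hker.comp_aemeasurable (h1.prodMk
        (measurable_snd.fst : Measurable fun q : Ω × ℝ × ℝ => q.2.1).aemeasurable)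
      have e2 := hker.comp_aemeasurable (h2.prodMk
        (measurable_snd.snd : Measurable fun q : Ω × ℝ × ℝ => q.2.2).aemeasurable)
      exact (e1.mul e2).aestronglyMeasurable
    rw [integrable_prod_iff hmeas]
    constructor
    · filter_upwards [hS0, hT0] with ω h1 h2
      exact (integrableOn_logKernel h1).mul_prod (integrableOn_logKernel h2)
    · have hc : MemLp (fun _ : Ω => logCenter) 2 P := memLp_const _
      -- Fubini is justified by the product of the two `|log| + logCenter`, integrable because both
      -- logarithms are in `L²`.
      have hb := (hS2.norm.add hc).integrable_mul (hT2.norm.add hc)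
      refine hb.mono' hmeas.norm.integral_prod_right' ?_
      filter_upwards [hS0, hT0] with ω h1 h2
      simp only [Function.uncurry_apply_pair, norm_mul, Pi.mul_apply, Pi.add_apply]
      rw [integral_prod_mul (fun t => ‖logKernel (S ω) t‖) (fun t => ‖logKernel (T ω) t‖)]
      have n1 : 0 ≤ ∫ t, ‖logKernel (S ω) t‖ ∂ν := integral_nonneg fun t => norm_nonneg _
      have n2 : 0 ≤ ∫ t, ‖logKernel (T ω) t‖ ∂ν := integral_nonneg fun t => norm_nonneg _
      rw [Real.norm_of_nonneg (mul_nonneg n1 n2)]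
      exact mul_le_mul (integral_norm_logKernel_le h1) (integral_norm_logKernel_le h2) n2
        (n1.trans (integral_norm_logKernel_le h1))
  have hE : ∀ t u : ℝ, 0 < t → 0 < u → ∫ ω, logKernel (S ω) t * logKernel (T ω) u ∂P =
      r * (((1 + t) * (1 + u)) * ((1 + t) * (1 + u) - r * (t * u)))⁻¹ := by
    intro t u ht hu
    have hbd : ∀ {U : Ω → ℝ} (_ : AEMeasurable U P) (_ : ∀ᵐ ω ∂P, 0 < U ω) {t : ℝ} (_ : 0 < t),
        MemLp (fun ω => Real.exp (-t * U ω)) 2 P := by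
      intro U hU hU0 t ht
      refine MemLp.of_bound
        ((Real.measurable_exp.comp_aemeasurable (hU.const_mul _)).aestronglyMeasurable) 1 ?_
      filter_upwards [hU0] with ω h
      rw [Real.norm_of_nonneg (Real.exp_pos _).le, Real.exp_le_one_iff]
      nlinarith
    have hs := hbd hS hS0 ht
    have hu' := hbd hT hT0 hu
    -- Of the four terms of the product, the first three each have expectation `± 1 / ((1 + t)(1 +
    -- u))` and sum to minus the product of the marginals.
    have e : ∀ ω, logKernel (S ω) t * logKernel (T ω) u = (t * u)⁻¹ *
        (((((1 + t)⁻¹ * (1 + u)⁻¹) - (1 + t)⁻¹ * Real.exp (-u * T ω)) -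
          (1 + u)⁻¹ * Real.exp (-t * S ω)) + Real.exp (-t * S ω) * Real.exp (-u * T ω)) := by
      intro ω
      simp only [logKernel, mul_inv]; ring
    simp_rw [e]
    have i1 := (hs.integrable (by norm_num)).const_mul (1 + u)⁻¹
    have i2 := (hu'.integrable (by norm_num)).const_mul (1 + t)⁻¹
    have i0 : Integrable (fun _ : Ω => (1 + t)⁻¹ * (1 + u)⁻¹) P := integrable_const _
    have i3 : Integrable (fun ω => (1 + t)⁻¹ * (1 + u)⁻¹ - (1 + t)⁻¹ * Real.exp (-u * T ω)) P :=
      i0.sub i2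
    have i4 : Integrable (fun ω => (1 + t)⁻¹ * (1 + u)⁻¹ - (1 + t)⁻¹ * Real.exp (-u * T ω) -
        (1 + u)⁻¹ * Real.exp (-t * S ω)) P := i3.sub i1
    have i5 : Integrable (fun ω => Real.exp (-t * S ω) * Real.exp (-u * T ω)) P :=
      hs.integrable_mul hu'
    rw [integral_const_mul, integral_add i4 i5, integral_sub i3 i1, integral_sub i0 i2, integral_const, integral_const_mul, integral_const_mul,
      hLS t ht.le, hLT u hu.le, hL t u ht.le hu.le]
    have hD : 0 < (1 + t) * (1 + u) - r * t * u := by nlinarith [mul_pos ht hu]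
    have hD' : (1 + t) * (1 + u) - r * (t * u) = (1 + t) * (1 + u) - r * t * u := by ring
    rw [hD']
    simp only [probReal_univ, one_smul]
    generalize hDD : (1 + t) * (1 + u) - r * t * u = D at *
    field_simp
    linear_combination hDD
  have hswap : ∫ ω, (Real.log (S ω) + logCenter) * (Real.log (T ω) + logCenter) ∂P =
      ∫ p : ℝ × ℝ, r * (((1 + p.1) * (1 + p.2)) *
        ((1 + p.1) * (1 + p.2) - r * (p.1 * p.2)))⁻¹ ∂(ν.prod ν) := by
    calc _ = ∫ ω, ∫ p : ℝ × ℝ, logKernel (S ω) p.1 * logKernel (T ω) p.2 ∂(ν.prod ν) ∂P := by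
          refine integral_congr_ae ?_
          filter_upwards [hS0, hT0] with ω h1 h2
          rw [integral_prod_mul, integral_logKernel h1, integral_logKernel h2]
      _ = _ := by
          rw [integral_integral_swap hint]
          exact integral_congr_ae (hae.mono fun p hp => hE p.1 p.2 hp.1 hp.2)
  rw [hswap, integral_const_mul, abs_mul, abs_of_nonneg hr0]
  refine mul_le_mul_of_nonneg_left ?_ hr0
  rw [← Real.norm_eq_abs, ← ENNReal.ofReal_le_ofReal_iff (by positivity), ofReal_norm]
  refine (enorm_integral_le_lintegral_enorm _).trans ?_
  rw [← lintegral_dilog_kernel]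
  refine lintegral_mono_ae (hae.mono fun p ⟨h1, h2⟩ => ?_)
  have hA : 0 < (1 + p.1) * (1 + p.2) := by positivity
  have hlt : p.1 * p.2 < (1 + p.1) * (1 + p.2) := by nlinarith
  have hle : r * (p.1 * p.2) ≤ p.1 * p.2 := by nlinarith [mul_pos h1 h2]
  have hpos : 0 < (1 + p.1) * (1 + p.2) - p.1 * p.2 := sub_pos.2 hlt
  rw [Real.enorm_of_nonneg (by
    have : 0 < (1 + p.1) * (1 + p.2) - r * (p.1 * p.2) := by linarith
    positivity)]
  refine ENNReal.ofReal_le_ofReal (inv_anti₀ (by positivity) ?_)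
  gcongr

/-! ### Spherical coordinates -/

local notation "E3" => EuclideanSpace ℝ (Fin 3)

/-- The point of `ℝ³` with cylindrical coordinates `q = (z, (x, y))` in the frame `b`. -/
def frameMap (b : OrthonormalBasis (Fin 3) ℝ E3) (q : ℝ × ℝ × ℝ) : E3 :=
  q.2.1 • b 0 + q.2.2 • b 1 + q.1 • b 2

theorem continuous_frameMap (b : OrthonormalBasis (Fin 3) ℝ E3) : Continuous (frameMap b) := by
  unfold frameMap; fun_prop

theorem norm_frameMap_sq (b : OrthonormalBasis (Fin 3) ℝ E3) (q : ℝ × ℝ × ℝ) :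
    ‖frameMap b q‖ ^ 2 = q.2.1 ^ 2 + q.2.2 ^ 2 + q.1 ^ 2 := by
  have hb := orthonormal_iff_ite.1 b.orthonormal
  rw [← real_inner_self_eq_norm_sq, frameMap]
  simp only [inner_add_left, inner_add_right, real_inner_smul_left, real_inner_smul_right, hb]
  simp
  ring

theorem measurePreserving_frameMap (b : OrthonormalBasis (Fin 3) ℝ E3) :
    MeasurePreserving (frameMap b) (volume : Measure (ℝ × ℝ × ℝ)) volume := by
  have h1 := (volume_preserving_piFinSuccAbove (fun _ : Fin 3 => ℝ) 2).symm
  have h2 := ((MeasurePreserving.id (volume : Measure ℝ)).prod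
    (volume_preserving_finTwoArrow ℝ).symm)
  have h3 := PiLp.volume_preserving_toLp (Fin 3)
  have h4 := b.measurePreserving_repr_symm
  have h5 := h4.comp (h3.comp (h1.comp h2))
  have e : frameMap b = (b.repr.symm ∘ WithLp.toLp 2 ∘
      (MeasurableEquiv.piFinSuccAbove (fun _ : Fin 3 => ℝ) 2).symm ∘
      Prod.map id MeasurableEquiv.finTwoArrow.symm) := by
    ext1 q
    simp only [Function.comp, ← OrthonormalBasis.sum_repr_symm, Fin.sum_univ_three, frameMap]
    rfl
  rw [e]
  exact h5

/-- The point of the sphere with spherical coordinates `q = (θ, φ)` in the frame `b`. -/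
def sphVec (b : OrthonormalBasis (Fin 3) ℝ E3) (q : ℝ × ℝ) : E3 :=
  (Real.sin q.1 * Real.cos q.2) • b 0 + (Real.sin q.1 * Real.sin q.2) • b 1 + Real.cos q.1 • b 2

theorem sphVec_eq_frameMap (b : OrthonormalBasis (Fin 3) ℝ E3) (q : ℝ × ℝ) :
    sphVec b q = frameMap b (Real.cos q.1, Real.sin q.1 * Real.cos q.2,
      Real.sin q.1 * Real.sin q.2) := rfl

theorem smul_sphVec (b : OrthonormalBasis (Fin 3) ℝ E3) (ρ : ℝ) (q : ℝ × ℝ) :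
    ρ • sphVec b q = frameMap b (ρ * Real.cos q.1, ρ * Real.sin q.1 * Real.cos q.2,
      ρ * Real.sin q.1 * Real.sin q.2) := by
  simp only [sphVec, frameMap, smul_add, smul_smul, mul_assoc]

theorem continuous_sphVec (b : OrthonormalBasis (Fin 3) ℝ E3) : Continuous (sphVec b) := by
  unfold sphVec; fun_prop

theorem norm_sphVec (b : OrthonormalBasis (Fin 3) ℝ E3) (q : ℝ × ℝ) : ‖sphVec b q‖ = 1 := by
  rw [← sq_eq_sq₀ (norm_nonneg _) zero_le_one, sphVec_eq_frameMap, norm_frameMap_sq]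
  simp only
  linear_combination Real.sin q.1 ^ 2 * Real.sin_sq_add_cos_sq q.2 + Real.sin_sq_add_cos_sq q.1

/-- Spherical coordinates in the frame `b`, as a map to the sphere. -/
def sphPoint (b : OrthonormalBasis (Fin 3) ℝ E3) (q : ℝ × ℝ) : S2 :=
  ⟨sphVec b q, by rw [mem_sphere_zero_iff_norm, norm_sphVec]⟩

theorem continuous_sphPoint (b : OrthonormalBasis (Fin 3) ℝ E3) : Continuous (sphPoint b) :=
  (continuous_sphVec b).subtype_mk _

/-- The rectangle of spherical coordinates. -/
def sphRect : Set (ℝ × ℝ) := Set.Ioo 0 Real.pi ×ˢ Set.Ioo (-Real.pi) Real.pi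

theorem measurableSet_sphRect : MeasurableSet sphRect := measurableSet_Ioo.prod measurableSet_Ioo

/-- The measure `sin θ dθ dφ / 4π` of spherical coordinates. -/
def sphMeasure : Measure (ℝ × ℝ) :=
  (volume.restrict sphRect).withDensity fun q => ENNReal.ofReal (Real.sin q.1 / (4 * Real.pi))

/-- Polar coordinates are applied twice, to `(x, y)` giving `(r, φ)` and then to `(z, r)` giving
`(ρ, θ)`. The Jacobian is `ρ * r = ρ² sin θ`. -/
theorem lintegral_eq_lintegral_spherical (b : OrthonormalBasis (Fin 3) ℝ E3) {f : E3 → ENNReal}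
    (hf : Measurable f) :
    ∫⁻ y, f y = ∫⁻ ρ in Set.Ioi (0 : ℝ), ENNReal.ofReal (ρ ^ 2) *
      ∫⁻ q in sphRect, ENNReal.ofReal (Real.sin q.1) * f (ρ • sphVec b q) := by
  have hF : Measurable (fun q : ℝ × ℝ × ℝ => f (frameMap b q)) :=
    hf.comp (continuous_frameMap b).measurable
  set K : ℝ → ℝ → ENNReal := fun z r => ∫⁻ φ in Set.Ioo (-Real.pi) Real.pi,
    f (frameMap b (z, r * Real.cos φ, r * Real.sin φ)) with hK
  have hKm : Measurable (Function.uncurry K) := by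
    have : Measurable fun q : (ℝ × ℝ) × ℝ =>
        f (frameMap b (q.1.1, q.1.2 * Real.cos q.2, q.1.2 * Real.sin q.2)) :=
      hF.comp (by fun_prop)
    exact this.lintegral_prod_right'
  set G : ℝ × ℝ → ENNReal := fun q =>
    (Set.univ ×ˢ Set.Ioi (0 : ℝ)).indicator (fun q => ENNReal.ofReal q.2 * K q.1 q.2) q with hG
  have hGm : Measurable G := by
    refine Measurable.indicator ?_ (MeasurableSet.univ.prod measurableSet_Ioi)
    exact (by fun_prop : Measurable fun q : ℝ × ℝ => ENNReal.ofReal q.2).mul hKm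
  rw [← (measurePreserving_frameMap b).lintegral_comp hf, Measure.volume_eq_prod,
    lintegral_prod _ hF.aemeasurable]
  have step1 : ∀ z : ℝ, ∫⁻ p : ℝ × ℝ, f (frameMap b (z, p)) = ∫⁻ r, G (z, r) := by
    intro z
    rw [← lintegral_comp_polarCoord_symm (fun p => f (frameMap b (z, p)))]
    have ht : polarCoord.target = Set.Ioi (0 : ℝ) ×ˢ Set.Ioo (-Real.pi) Real.pi := rfl
    rw [ht, Measure.volume_eq_prod, ← Measure.prod_restrict, lintegral_prod]
    · rw [← lintegral_indicator measurableSet_Ioi]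
      refine lintegral_congr fun r => ?_
      by_cases hr : 0 < r
      · have : (z, r) ∈ Set.univ ×ˢ Set.Ioi (0 : ℝ) := ⟨trivial, hr⟩
        rw [Set.indicator_of_mem (show r ∈ Set.Ioi (0 : ℝ) from hr), hG]
        simp only [Set.indicator_of_mem this, smul_eq_mul]
        rw [lintegral_const_mul' _ _ ENNReal.ofReal_ne_top]
        rfl
      · have : (z, r) ∉ Set.univ ×ˢ Set.Ioi (0 : ℝ) := fun h => hr h.2
        rw [Set.indicator_of_notMem (show r ∉ Set.Ioi (0 : ℝ) from hr), hG]
        simp only [Set.indicator_of_notMem this]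
    · refine Measurable.aemeasurable ?_
      simp only [polarCoord_symm_apply, smul_eq_mul]
      exact (by fun_prop : Measurable fun q : ℝ × ℝ => ENNReal.ofReal q.1).mul
        (hF.comp (f := fun q : ℝ × ℝ => (z, q.1 * Real.cos q.2, q.1 * Real.sin q.2)) (by fun_prop))
  simp_rw [step1]
  rw [← lintegral_prod _ hGm.aemeasurable, ← Measure.volume_eq_prod,
    ← lintegral_comp_polarCoord_symm G]
  have ht : polarCoord.target = Set.Ioi (0 : ℝ) ×ˢ Set.Ioo (-Real.pi) Real.pi := rfl
  simp only [polarCoord_symm_apply, smul_eq_mul]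
  rw [ht, Measure.volume_eq_prod, ← Measure.prod_restrict, lintegral_prod]
  swap
  · exact ((by fun_prop : Measurable fun q : ℝ × ℝ => ENNReal.ofReal q.1).mul
      (hGm.comp (f := fun q : ℝ × ℝ => (q.1 * Real.cos q.2, q.1 * Real.sin q.2))
        (by fun_prop))).aemeasurable
  refine setLIntegral_congr_fun measurableSet_Ioi fun ρ (hρ : 0 < ρ) => ?_
  simp only
  have hsq : ENNReal.ofReal (ρ ^ 2) = ENNReal.ofReal ρ * ENNReal.ofReal ρ := by
    rw [← ENNReal.ofReal_mul hρ.le, sq]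
  rw [lintegral_const_mul' _ _ ENNReal.ofReal_ne_top, hsq, mul_assoc]
  congr 1
  -- The second polar angle runs over `(-π, π)`, but `r > 0` forces `sin θ > 0`, which leaves the
  -- colatitudes `(0, π)`.
  have hind : ∀ θ ∈ Set.Ioo (-Real.pi) Real.pi, G (ρ * Real.cos θ, ρ * Real.sin θ) =
      (Set.Ioo 0 Real.pi).indicator (fun θ => ENNReal.ofReal ρ *
        ∫⁻ φ in Set.Ioo (-Real.pi) Real.pi,
          ENNReal.ofReal (Real.sin θ) * f (ρ • sphVec b (θ, φ))) θ := by
    intro θ hθ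
    by_cases h0 : 0 < θ
    · have hs : 0 < ρ * Real.sin θ := mul_pos hρ (Real.sin_pos_of_pos_of_lt_pi h0 hθ.2)
      have hm : (ρ * Real.cos θ, ρ * Real.sin θ) ∈ Set.univ ×ˢ Set.Ioi (0 : ℝ) := ⟨trivial, hs⟩
      rw [hG, Set.indicator_of_mem (show θ ∈ Set.Ioo 0 Real.pi from ⟨h0, hθ.2⟩)]
      simp only [Set.indicator_of_mem hm]
      rw [lintegral_const_mul' _ _ ENNReal.ofReal_ne_top, ENNReal.ofReal_mul hρ.le, mul_assoc]
      simp_rw [smul_sphVec]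
      rfl
    · have hs : Real.sin θ ≤ 0 := Real.sin_nonpos_of_nonpos_of_neg_pi_le (not_lt.1 h0) hθ.1.le
      have hm : (ρ * Real.cos θ, ρ * Real.sin θ) ∉ Set.univ ×ˢ Set.Ioi (0 : ℝ) :=
        fun h => absurd h.2 (not_lt.2 (mul_nonpos_of_nonneg_of_nonpos hρ.le hs))
      rw [hG, Set.indicator_of_notMem (show θ ∉ Set.Ioo 0 Real.pi from fun h => h0 h.1)]
      simp only [Set.indicator_of_notMem hm]
  have hsub : Set.Ioo 0 Real.pi ∩ Set.Ioo (-Real.pi) Real.pi = Set.Ioo 0 Real.pi :=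
    Set.inter_eq_left.2 (Set.Ioo_subset_Ioo_left (by linarith [Real.pi_pos]))
  rw [setLIntegral_congr_fun measurableSet_Ioo hind, setLIntegral_indicator measurableSet_Ioo,
    hsub, lintegral_const_mul' _ _ ENNReal.ofReal_ne_top, sphRect, ← Measure.prod_restrict,
    lintegral_prod]
  exact ((by fun_prop : Measurable fun q : ℝ × ℝ => ENNReal.ofReal (Real.sin q.1)).mul
    (hf.comp ((continuous_sphVec b).const_smul ρ).measurable)).aemeasurable

theorem toSphere_univ :
    (volume : Measure E3).toSphere Set.univ = ENNReal.ofReal (4 * Real.pi) := by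
  rw [Measure.toSphere_apply_univ, EuclideanSpace.volume_ball_fin_three, finrank_euclideanSpace,
    Fintype.card_fin, ← ENNReal.ofReal_natCast, ← ENNReal.ofReal_pow (by norm_num),
    ← ENNReal.ofReal_mul (by positivity), ← ENNReal.ofReal_mul (by positivity)]
  congr 1
  push_cast; ring

open scoped Pointwise in
-- By definition `toSphere s` is three times the volume of the cone over `s` in the unit ball; the
-- radial integral `∫₀¹ ρ² dρ = 1/3` cancels the factor.
theorem toSphere_apply_eq_lintegral (b : OrthonormalBasis (Fin 3) ℝ E3) {s : Set S2}
    (hs : MeasurableSet s) :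
    (volume : Measure E3).toSphere s =
      ∫⁻ q in sphRect, ENNReal.ofReal (Real.sin q.1) * (sphPoint b ⁻¹' s).indicator 1 q := by
  have hcone : (Set.Ioo (0 : ℝ) 1 • (Subtype.val '' s) : Set E3) =
      {y : E3 | 0 < ‖y‖ ∧ ‖y‖ < 1 ∧ ‖y‖⁻¹ • y ∈ (Subtype.val '' s : Set E3)} := by
    ext y
    rw [Set.mem_smul]
    constructor
    · rintro ⟨r, hr, _, ⟨x, hx, rfl⟩, rfl⟩
      have hn : ‖r • (x : E3)‖ = r := by
        rw [norm_smul, norm_eq_of_mem_sphere, mul_one, Real.norm_of_nonneg hr.1.le]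
      refine ⟨by rw [hn]; exact hr.1, by rw [hn]; exact hr.2, ?_⟩
      rw [hn, smul_smul, inv_mul_cancel₀ hr.1.ne', one_smul]
      exact ⟨x, hx, rfl⟩
    · rintro ⟨h0, h1, h2⟩
      exact ⟨‖y‖, ⟨h0, h1⟩, _, h2, by rw [smul_smul, mul_inv_cancel₀ h0.ne', one_smul]⟩
  have hsm : MeasurableSet (Subtype.val '' s : Set E3) :=
    (MeasurableEmbedding.subtype_coe Metric.isClosed_sphere.measurableSet).measurableSet_image.2 hs
  have hcm : MeasurableSet {y : E3 | 0 < ‖y‖ ∧ ‖y‖ < 1 ∧ ‖y‖⁻¹ • y ∈ (Subtype.val '' s : Set E3)} := by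
    refine (measurableSet_lt measurable_const measurable_norm).inter
      ((measurableSet_lt measurable_norm measurable_const).inter ?_)
    exact (by fun_prop : Measurable fun y : E3 => ‖y‖⁻¹ • y) hsm
  set C := {y : E3 | 0 < ‖y‖ ∧ ‖y‖ < 1 ∧ ‖y‖⁻¹ • y ∈ (Subtype.val '' s : Set E3)}
  set A := ∫⁻ q in sphRect, ENNReal.ofReal (Real.sin q.1) * (sphPoint b ⁻¹' s).indicator 1 q
  have hrad : ∀ ρ : ℝ, 0 < ρ → ∫⁻ q in sphRect, ENNReal.ofReal (Real.sin q.1) *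
      C.indicator 1 (ρ • sphVec b q) = (Set.Ioo (0 : ℝ) 1).indicator (fun _ => A) ρ := by
    intro ρ hρ
    have hn : ∀ q, ‖ρ • sphVec b q‖ = ρ := fun q => by
      rw [norm_smul, norm_sphVec, mul_one, Real.norm_of_nonneg hρ.le]
    have hmem : ∀ q, ρ • sphVec b q ∈ C ↔ ρ < 1 ∧ sphPoint b q ∈ s := by
      intro q
      change 0 < ‖ρ • sphVec b q‖ ∧ ‖ρ • sphVec b q‖ < 1 ∧
        ‖ρ • sphVec b q‖⁻¹ • ρ • sphVec b q ∈ (Subtype.val '' s : Set E3) ↔ _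
      rw [hn, smul_smul, inv_mul_cancel₀ hρ.ne', one_smul]
      refine ⟨fun ⟨_, h1, x, hx, hxe⟩ => ⟨h1, ?_⟩, fun ⟨h1, h2⟩ => ⟨hρ, h1, _, h2, rfl⟩⟩
      have : sphPoint b q = x := Subtype.ext hxe.symm
      rwa [this]
    by_cases h1 : ρ < 1
    · rw [Set.indicator_of_mem (show ρ ∈ Set.Ioo (0 : ℝ) 1 from ⟨hρ, h1⟩)]
      refine lintegral_congr fun q => congrArg _ ?_
      by_cases hq : sphPoint b q ∈ s
      · rw [Set.indicator_of_mem ((hmem q).2 ⟨h1, hq⟩), Set.indicator_of_mem (by exact hq)]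
        rfl
      · rw [Set.indicator_of_notMem (fun h => hq ((hmem q).1 h).2),
          Set.indicator_of_notMem (by exact hq)]
    · rw [Set.indicator_of_notMem (fun h => h1 h.2)]
      refine (lintegral_congr fun q => ?_).trans lintegral_zero
      rw [Set.indicator_of_notMem (fun h => h1 ((hmem q).1 h).1), mul_zero]
  rw [Measure.toSphere_apply' _ hs, hcone, ← lintegral_indicator_one hcm,
    lintegral_eq_lintegral_spherical b (measurable_one.indicator hcm),
    setLIntegral_congr_fun (g := (Set.Ioo (0 : ℝ) 1).indicator
      (fun ρ => ENNReal.ofReal (ρ ^ 2) * A)) measurableSet_Ioi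
      (fun ρ (hρ : 0 < ρ) => ?_)]
  · rw [setLIntegral_indicator measurableSet_Ioo,
      Set.inter_eq_left.2 (fun x hx => hx.1), lintegral_mul_const _ (by fun_prop),
      ← ofReal_integral_eq_lintegral_ofReal, ← integral_Ioc_eq_integral_Ioo,
      ← intervalIntegral.integral_of_le zero_le_one, integral_pow, finrank_euclideanSpace,
      Fintype.card_fin, ← mul_assoc, ← ENNReal.ofReal_natCast,
      ← ENNReal.ofReal_mul (by positivity)]
    · norm_num
    · exact ((continuous_pow 2).integrableOn_Icc).mono_set Set.Ioo_subset_Icc_self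
    · exact Filter.Eventually.of_forall fun x => sq_nonneg x
  · rw [hrad ρ hρ]
    by_cases h1 : ρ ∈ Set.Ioo (0 : ℝ) 1
    · rw [Set.indicator_of_mem h1, Set.indicator_of_mem h1]
    · rw [Set.indicator_of_notMem h1, Set.indicator_of_notMem h1, mul_zero]

theorem measurePreserving_sphPoint (b : OrthonormalBasis (Fin 3) ℝ E3) :
    MeasurePreserving (sphPoint b) sphMeasure vol := by
  refine ⟨(continuous_sphPoint b).measurable, ?_⟩
  ext s hs
  have hp := (continuous_sphPoint b).measurable hs
  rw [Measure.map_apply (continuous_sphPoint b).measurable hs, sphMeasure,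
    withDensity_apply _ hp, vol, Measure.smul_apply, toSphere_univ, smul_eq_mul,
    toSphere_apply_eq_lintegral b hs, ← lintegral_indicator hp,
    ← ENNReal.ofReal_inv_of_pos (by positivity),
    ← lintegral_const_mul' _ _ ENNReal.ofReal_ne_top]
  refine lintegral_congr fun q => ?_
  by_cases hq : q ∈ sphPoint b ⁻¹' s
  · rw [Set.indicator_of_mem hq, Set.indicator_of_mem hq, Pi.one_apply, mul_one,
      ← ENNReal.ofReal_mul (by positivity), div_eq_inv_mul]
  · rw [Set.indicator_of_notMem hq, Set.indicator_of_notMem hq, mul_zero, mul_zero]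

instance : IsProbabilityMeasure vol := by
  refine ⟨?_⟩
  rw [vol, Measure.smul_apply, smul_eq_mul, toSphere_univ]
  exact ENNReal.inv_mul_cancel (by simp [Real.pi_pos]) ENNReal.ofReal_ne_top

/-- Integration over the sphere in spherical coordinates. -/
theorem integral_vol_eq (b : OrthonormalBasis (Fin 3) ℝ E3) {f : S2 → ℝ}
    (hf : AEStronglyMeasurable f vol) :
    ∫ x, f x ∂vol =
      ∫ q in sphRect, Real.sin q.1 / (4 * Real.pi) * f (sphPoint b q) := by
  have h := measurePreserving_sphPoint b
  rw [← h.map_eq] at hf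
  rw [← h.map_eq, integral_map h.measurable.aemeasurable hf, sphMeasure,
    integral_withDensity_eq_integral_toReal_smul (by fun_prop) (by simp)]
  refine setIntegral_congr_fun measurableSet_sphRect fun q hq => ?_
  have := (Real.sin_pos_of_pos_of_lt_pi hq.1.1 hq.1.2).le
  simp only [smul_eq_mul]
  rw [ENNReal.toReal_ofReal (by positivity)]

theorem integrable_vol_iff (b : OrthonormalBasis (Fin 3) ℝ E3) {f : S2 → ℝ}
    (hf : AEStronglyMeasurable f vol) :
    Integrable f vol ↔
      IntegrableOn (fun q => f (sphPoint b q) * (Real.sin q.1 / (4 * Real.pi))) sphRect := by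
  have h := measurePreserving_sphPoint b
  rw [← h.integrable_comp hf, sphMeasure, integrable_withDensity_iff (by fun_prop) (by simp)]
  refine integrableOn_congr_fun (fun q hq => ?_) measurableSet_sphRect
  have := (Real.sin_pos_of_pos_of_lt_pi hq.1.1 hq.1.2).le
  rw [ENNReal.toReal_ofReal (by positivity)]
  rfl

theorem exists_orthonormalBasis_two (x : S2) :
    ∃ b : OrthonormalBasis (Fin 3) ℝ E3, b 2 = x := by
  have hv : Orthonormal ℝ (({2} : Set (Fin 3)).domRestrict fun _ => (x : E3)) := by
    refine ⟨fun i => norm_eq_of_mem_sphere x, fun i j hij => ?_⟩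
    exact absurd (Subtype.ext (i.2.trans j.2.symm)) hij
  obtain ⟨b, hb⟩ := hv.exists_orthonormalBasis_extension_of_card_eq (by simp)
  exact ⟨b, hb 2 rfl⟩

/-! ### Green's formula for eigenfunctions -/

theorem hasDerivAt_intervalIntegral_of_continuous {f f' : ℝ → ℝ → ℝ}
    (hf : Continuous (Function.uncurry f)) (hf' : Continuous (Function.uncurry f'))
    (hd : ∀ x t, HasDerivAt (fun x => f x t) (f' x t) x) (a b x₀ : ℝ) :
    HasDerivAt (fun x => ∫ t in a..b, f x t) (∫ t in a..b, f' x₀ t) x₀ := by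
  have hK : IsCompact (Metric.closedBall x₀ 1 ×ˢ Set.uIcc a b) :=
    (isCompact_closedBall x₀ 1).prod isCompact_uIcc
  obtain ⟨C, hC⟩ := hK.exists_bound_of_continuousOn hf'.continuousOn
  have hcx : ∀ x, Continuous (f x) := fun x => hf.comp (by fun_prop : Continuous fun t => (x, t))
  have hcx' : ∀ x, Continuous (f' x) := fun x => hf'.comp (by fun_prop : Continuous fun t => (x, t))
  refine (intervalIntegral.hasDerivAt_integral_of_dominated_loc_of_deriv_le (bound := fun _ => C)
    (Metric.ball_mem_nhds x₀ one_pos)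
    (Filter.Eventually.of_forall fun x => (hcx x).aestronglyMeasurable)
    ((hcx x₀).intervalIntegrable _ _) (hcx' x₀).aestronglyMeasurable
    (Filter.Eventually.of_forall fun t ht x hx => ?_) intervalIntegrable_const
    (Filter.Eventually.of_forall fun t _ x _ => hd x t)).2
  exact hC (x, t) ⟨Metric.ball_subset_closedBall hx, Set.uIoc_subset_uIcc ht⟩

theorem radialExtension_coe (Y : S2 → ℝ) (x : S2) : radialExtension Y x = Y x := by
  have hn : ‖(x : E3)‖ = 1 := norm_eq_of_mem_sphere x
  have hx : (x : E3) ≠ 0 := norm_ne_zero_iff.1 (by rw [hn]; exact one_ne_zero)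
  rw [radialExtension, dif_neg hx]
  congr 1
  ext1
  simp [hn]

theorem radialExtension_smul (Y : S2 → ℝ) {c : ℝ} (hc : 0 < c) (y : E3) :
    radialExtension Y (c • y) = radialExtension Y y := by
  by_cases hy : y = 0
  · rw [hy, smul_zero]
  have hcy : c • y ≠ 0 := smul_ne_zero hc.ne' hy
  rw [radialExtension, radialExtension, dif_neg hy, dif_neg hcy]
  congr 1
  ext1
  simp only [norm_smul, Real.norm_of_nonneg hc.le, smul_smul]
  congr 1
  field_simp

section Derivatives

variable {F : E3 → ℝ} (hF : ContDiffOn ℝ 2 F {0}ᶜ)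

include hF

theorem hasFDerivAt_of_contDiffOn_compl {y : E3} (hy : y ≠ 0) :
    HasFDerivAt F (fderiv ℝ F y) y :=
  ((hF.contDiffAt (isOpen_compl_singleton.mem_nhds hy)).differentiableAt
    (by norm_num)).hasFDerivAt

theorem contDiffOn_fderiv_compl : ContDiffOn ℝ 1 (fderiv ℝ F) {0}ᶜ :=
  hF.fderiv_of_isOpen isOpen_compl_singleton (by norm_num)

theorem hasFDerivAt_fderiv_of_contDiffOn_compl {y : E3} (hy : y ≠ 0) :
    HasFDerivAt (fderiv ℝ F) (fderiv ℝ (fderiv ℝ F) y) y :=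
  (((contDiffOn_fderiv_compl hF).contDiffAt
    (isOpen_compl_singleton.mem_nhds hy)).differentiableAt (by norm_num)).hasFDerivAt

theorem continuousOn_fderiv_fderiv_compl : ContinuousOn (fderiv ℝ (fderiv ℝ F)) {0}ᶜ :=
  (contDiffOn_fderiv_compl hF).continuousOn_fderiv_of_isOpen isOpen_compl_singleton le_rfl

theorem hasDerivAt_comp_curve {γ : ℝ → E3} {γ' : E3} {s : ℝ} (h0 : γ s ≠ 0)
    (hγ : HasDerivAt γ γ' s) : HasDerivAt (fun s => F (γ s)) (fderiv ℝ F (γ s) γ') s :=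
  (hasFDerivAt_of_contDiffOn_compl hF h0).comp_hasDerivAt s hγ

theorem hasDerivAt_fderiv_comp_curve {γ γ' : ℝ → E3} {γ'' : E3} {s : ℝ} (h0 : γ s ≠ 0)
    (hγ : HasDerivAt γ (γ' s) s) (hγ' : HasDerivAt γ' γ'' s) :
    HasDerivAt (fun s => fderiv ℝ F (γ s) (γ' s))
      (fderiv ℝ (fderiv ℝ F) (γ s) (γ' s) (γ' s) + fderiv ℝ F (γ s) γ'') s :=
  ((hasFDerivAt_fderiv_of_contDiffOn_compl hF h0).comp_hasDerivAt s hγ).clm_apply hγ'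

theorem fderiv_apply_self_of_radial (hrad : ∀ (c : ℝ) (y : E3), 0 < c → F (c • y) = F y)
    {y : E3} (hy : y ≠ 0) : fderiv ℝ F y y = 0 := by
  have h1 : HasDerivAt (fun c : ℝ => F (c • y)) (fderiv ℝ F ((1 : ℝ) • y) y) 1 :=
    hasDerivAt_comp_curve hF (by simpa using hy) (by simpa using (hasDerivAt_id (1 : ℝ)).smul_const y)
  have h2 : HasDerivAt (fun c : ℝ => F (c • y)) 0 1 := by
    refine (hasDerivAt_const (1 : ℝ) (F y)).congr_of_eventuallyEq ?_
    filter_upwards [lt_mem_nhds one_pos] with c hc using hrad c y hc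
  simpa using h1.unique h2

/-- Along the ray through `y`, the derivative in the direction `y` vanishes identically, and so does
its own derivative. Hence the radial direction contributes nothing to the Laplacian on the sphere.
-/
theorem fderiv_fderiv_apply_self_of_radial
    (hrad : ∀ (c : ℝ) (y : E3), 0 < c → F (c • y) = F y) {y : E3} (hy : y ≠ 0) :
    fderiv ℝ (fderiv ℝ F) y y y = 0 := by
  have hne : (1 : ℝ) • y ≠ 0 := by simpa using hy
  have hs : HasDerivAt (fun c : ℝ => c • y) y 1 := by
    simpa using (hasDerivAt_id (1 : ℝ)).smul_const y
  have h1 := hasDerivAt_fderiv_comp_curve (γ := fun c : ℝ => c • y) (γ' := fun c : ℝ => y) hF hne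
    hs (hasDerivAt_const (1 : ℝ) y)
  have h2 : HasDerivAt (fun c : ℝ => fderiv ℝ F (c • y) y) 0 1 := by
    refine (hasDerivAt_const (1 : ℝ) (0 : ℝ)).congr_of_eventuallyEq ?_
    filter_upwards [lt_mem_nhds one_pos] with c hc
    have := fderiv_apply_self_of_radial hF hrad (smul_ne_zero hc.ne' hy)
    rw [map_smul, smul_eq_mul] at this
    exact (mul_eq_zero.1 this).resolve_left hc.ne'
  have := h1.unique h2
  simpa using this

end Derivatives

/-! #### The eigenvalue equation in spherical coordinates -/

section Frame

variable (b : OrthonormalBasis (Fin 3) ℝ E3)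

/-- The derivative of `sphVec` in `θ`. -/
def sphVecTheta (q : ℝ × ℝ) : E3 :=
  (Real.cos q.1 * Real.cos q.2) • b 0 + (Real.cos q.1 * Real.sin q.2) • b 1 + (-Real.sin q.1) • b 2

/-- The unit vector in the direction of increasing `φ`. -/
def sphVecPhi (q : ℝ × ℝ) : E3 :=
  (-Real.sin q.2) • b 0 + Real.cos q.2 • b 1 + (0 : ℝ) • b 2

theorem continuous_sphVecTheta : Continuous (sphVecTheta b) := by
  unfold sphVecTheta; fun_prop

theorem sphVec_ne_zero (q : ℝ × ℝ) : sphVec b q ≠ 0 :=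
  norm_ne_zero_iff.1 (by rw [norm_sphVec]; exact one_ne_zero)

theorem hasDerivAt_frame {α β γ : ℝ → ℝ} {α' β' γ' s : ℝ} (hα : HasDerivAt α α' s)
    (hβ : HasDerivAt β β' s) (hγ : HasDerivAt γ γ' s) :
    HasDerivAt (fun s => α s • b 0 + β s • b 1 + γ s • b 2)
      (α' • b 0 + β' • b 1 + γ' • b 2) s :=
  ((hα.smul_const (b 0)).add (hβ.smul_const (b 1))).add (hγ.smul_const (b 2))

theorem hasDerivAt_sphVec_theta (θ φ : ℝ) :
    HasDerivAt (fun θ => sphVec b (θ, φ)) (sphVecTheta b (θ, φ)) θ :=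
  hasDerivAt_frame b ((Real.hasDerivAt_sin θ).mul_const (Real.cos φ))
    ((Real.hasDerivAt_sin θ).mul_const (Real.sin φ)) (Real.hasDerivAt_cos θ)

theorem hasDerivAt_sphVecTheta_theta (θ φ : ℝ) :
    HasDerivAt (fun θ => sphVecTheta b (θ, φ)) (-sphVec b (θ, φ)) θ := by
  refine (hasDerivAt_frame b ((Real.hasDerivAt_cos θ).mul_const (Real.cos φ))
    ((Real.hasDerivAt_cos θ).mul_const (Real.sin φ)) (Real.hasDerivAt_sin θ).neg).congr_deriv ?_
  simp only [sphVec]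
  module

theorem hasDerivAt_sphVec_phi (θ φ : ℝ) :
    HasDerivAt (fun φ => sphVec b (θ, φ)) (Real.sin θ • sphVecPhi b (θ, φ)) φ := by
  refine (hasDerivAt_frame b ((Real.hasDerivAt_cos φ).const_mul (Real.sin θ))
    ((Real.hasDerivAt_sin φ).const_mul (Real.sin θ))
    (hasDerivAt_const φ (Real.cos θ))).congr_deriv ?_
  simp only [sphVecPhi]
  module

/-- The acceleration along a circle of latitude points to the axis. Its meridional component `cos θ`
is the source of the first-order term of the spherical Laplacian. -/
theorem hasDerivAt_sphVecPhi_phi (θ φ : ℝ) :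
    HasDerivAt (fun φ => Real.sin θ • sphVecPhi b (θ, φ))
      (-(Real.sin θ) • (Real.sin θ • sphVec b (θ, φ) + Real.cos θ • sphVecTheta b (θ, φ))) φ := by
  have h1 := ((((Real.hasDerivAt_sin φ).neg.smul_const (b 0)).add
    ((Real.hasDerivAt_cos φ).smul_const (b 1))).add
    (hasDerivAt_const φ ((0 : ℝ) • b 2))).const_smul (Real.sin θ)
  refine HasDerivAt.congr_deriv (f := fun φ => Real.sin θ • sphVecPhi b (θ, φ)) h1 ?_
  simp only [sphVec, sphVecTheta]
  have h := Real.sin_sq_add_cos_sq θ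
  match_scalars
  · linear_combination Real.sin θ * Real.cos φ * h
  · linear_combination Real.sin θ * Real.sin φ * h
  · ring

theorem inner_frame (α β γ α' β' γ' : ℝ) :
    inner ℝ (α • b 0 + β • b 1 + γ • b 2) (α' • b 0 + β' • b 1 + γ' • b 2) =
      α * α' + β * β' + γ * γ' := by
  have hb := orthonormal_iff_ite.1 b.orthonormal
  simp only [inner_add_left, inner_add_right, real_inner_smul_left, real_inner_smul_right, hb]
  simp
  ring

/-- The orthonormal frame of spherical coordinates. -/
theorem orthonormal_sphFrame (q : ℝ × ℝ) :
    Orthonormal ℝ ![sphVec b q, sphVecTheta b q, sphVecPhi b q] := by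
  have h1 := Real.sin_sq_add_cos_sq q.1
  have h2 := Real.sin_sq_add_cos_sq q.2
  have e00 : inner ℝ (sphVec b q) (sphVec b q) = 1 := by
    rw [sphVec, inner_frame]; linear_combination Real.sin q.1 ^ 2 * h2 + h1
  have e01 : inner ℝ (sphVec b q) (sphVecTheta b q) = 0 := by
    rw [sphVec, sphVecTheta, inner_frame]
    linear_combination Real.sin q.1 * Real.cos q.1 * h2
  have e02 : inner ℝ (sphVec b q) (sphVecPhi b q) = 0 := by
    rw [sphVec, sphVecPhi, inner_frame]; ring
  have e11 : inner ℝ (sphVecTheta b q) (sphVecTheta b q) = 1 := by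
    rw [sphVecTheta, inner_frame]; linear_combination Real.cos q.1 ^ 2 * h2 + h1
  have e12 : inner ℝ (sphVecTheta b q) (sphVecPhi b q) = 0 := by
    rw [sphVecTheta, sphVecPhi, inner_frame]; ring
  have e22 : inner ℝ (sphVecPhi b q) (sphVecPhi b q) = 1 := by
    rw [sphVecPhi, inner_frame]; linear_combination h2
  rw [orthonormal_iff_ite]
  intro i j
  fin_cases i <;> fin_cases j
  · exact e00
  · exact e01
  · exact e02
  · exact (real_inner_comm _ _).trans e01
  · exact e11
  · exact e12
  · exact (real_inner_comm _ _).trans e02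
  · exact (real_inner_comm _ _).trans e12
  · exact e22

/-- The trace of the Hessian may be taken in any orthonormal basis, in particular in the moving
frame at the point. -/
theorem laplacian_eq_sum_sphFrame {F : E3 → ℝ} (q : ℝ × ℝ) :
    Laplacian.laplacian F (sphVec b q) =
      fderiv ℝ (fderiv ℝ F) (sphVec b q) (sphVec b q) (sphVec b q) +
      fderiv ℝ (fderiv ℝ F) (sphVec b q) (sphVecTheta b q) (sphVecTheta b q) +
      fderiv ℝ (fderiv ℝ F) (sphVec b q) (sphVecPhi b q) (sphVecPhi b q) := by
  have ho := orthonormal_sphFrame b q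
  let e := OrthonormalBasis.mk ho (by
    rw [ho.linearIndependent.span_eq_top_of_card_eq_finrank' (by simp)])
  rw [InnerProductSpace.laplacian_eq_iteratedFDeriv_orthonormalBasis F e]
  simp [Fin.sum_univ_three, iteratedFDeriv_two_apply, e]

end Frame

/-! ### Integrals over circles of latitude and a one-variable Green identity -/

section SphericalMean

variable {F : E3 → ℝ} {lam : ℝ} (b : OrthonormalBasis (Fin 3) ℝ E3)

/-- The derivative in `θ` of `F` in spherical coordinates. -/
def sphDeriv (F : E3 → ℝ) (q : ℝ × ℝ) : ℝ := fderiv ℝ F (sphVec b q) (sphVecTheta b q)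

/-- The second derivative in `θ` of a radial function `F` in spherical coordinates. -/
def sphDeriv₂ (F : E3 → ℝ) (q : ℝ × ℝ) : ℝ :=
  fderiv ℝ (fderiv ℝ F) (sphVec b q) (sphVecTheta b q) (sphVecTheta b q)

theorem continuous_comp_sphVec (hF : ContDiffOn ℝ 2 F {0}ᶜ) :
    Continuous fun q => F (sphVec b q) :=
  hF.continuousOn.comp_continuous (continuous_sphVec b) (sphVec_ne_zero b)

theorem continuous_sphDeriv (hF : ContDiffOn ℝ 2 F {0}ᶜ) : Continuous (sphDeriv b F) :=
  ((contDiffOn_fderiv_compl hF).continuousOn.comp_continuous (continuous_sphVec b)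
    (sphVec_ne_zero b)).clm_apply (continuous_sphVecTheta b)

theorem continuous_sphDeriv₂ (hF : ContDiffOn ℝ 2 F {0}ᶜ) : Continuous (sphDeriv₂ b F) :=
  (((continuousOn_fderiv_fderiv_compl hF).comp_continuous (continuous_sphVec b)
    (sphVec_ne_zero b)).clm_apply (continuous_sphVecTheta b)).clm_apply (continuous_sphVecTheta b)

theorem hasDerivAt_comp_sphVec_theta (hF : ContDiffOn ℝ 2 F {0}ᶜ) (θ φ : ℝ) :
    HasDerivAt (fun θ => F (sphVec b (θ, φ))) (sphDeriv b F (θ, φ)) θ :=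
  hasDerivAt_comp_curve hF (sphVec_ne_zero b _) (hasDerivAt_sphVec_theta b θ φ)

theorem hasDerivAt_sphDeriv (hF : ContDiffOn ℝ 2 F {0}ᶜ)
    (hrad : ∀ (c : ℝ) (y : E3), 0 < c → F (c • y) = F y) (θ φ : ℝ) :
    HasDerivAt (fun θ => sphDeriv b F (θ, φ)) (sphDeriv₂ b F (θ, φ)) θ := by
  refine (hasDerivAt_fderiv_comp_curve hF (sphVec_ne_zero b _) (hasDerivAt_sphVec_theta b θ φ)
    (hasDerivAt_sphVecTheta_theta b θ φ)).congr_deriv ?_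
  rw [map_neg, fderiv_apply_self_of_radial hF hrad (sphVec_ne_zero b _), neg_zero, add_zero,
    sphDeriv₂]

/-- The integral of `F` over the circle of latitude `θ`. -/
def latitudeIntegral (F : E3 → ℝ) (θ : ℝ) : ℝ := ∫ φ in (-Real.pi)..Real.pi, F (sphVec b (θ, φ))

/-- The integral of the derivative `∂F/∂θ` over the circle of latitude `θ`. -/
def latitudeFlux (F : E3 → ℝ) (θ : ℝ) : ℝ := ∫ φ in (-Real.pi)..Real.pi, sphDeriv b F (θ, φ)

theorem hasDerivAt_latitudeIntegral (hF : ContDiffOn ℝ 2 F {0}ᶜ) (θ : ℝ) :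
    HasDerivAt (latitudeIntegral b F) (latitudeFlux b F θ) θ :=
  hasDerivAt_intervalIntegral_of_continuous (f := fun θ φ => F (sphVec b (θ, φ)))
    (f' := fun θ φ => sphDeriv b F (θ, φ)) (continuous_comp_sphVec b hF)
    (continuous_sphDeriv b hF) (hasDerivAt_comp_sphVec_theta b hF) _ _ θ

theorem hasDerivAt_latitudeFlux (hF : ContDiffOn ℝ 2 F {0}ᶜ)
    (hrad : ∀ (c : ℝ) (y : E3), 0 < c → F (c • y) = F y) (θ : ℝ) :
    HasDerivAt (latitudeFlux b F) (∫ φ in (-Real.pi)..Real.pi, sphDeriv₂ b F (θ, φ)) θ :=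
  hasDerivAt_intervalIntegral_of_continuous (f := fun θ φ => sphDeriv b F (θ, φ))
    (f' := fun θ φ => sphDeriv₂ b F (θ, φ)) (continuous_sphDeriv b hF)
    (continuous_sphDeriv₂ b hF) (hasDerivAt_sphDeriv b hF hrad) _ _ θ

/-- The second `φ`-derivative is the derivative of a `2π`-periodic function and integrates to zero
over a circle of latitude; the eigenvalue equation then becomes an ordinary differential equation in
`θ`. The factor `sin² θ` avoids division at the poles. -/
theorem integral_sphDeriv₂ (hF : ContDiffOn ℝ 2 F {0}ᶜ)
    (hrad : ∀ (c : ℝ) (y : E3), 0 < c → F (c • y) = F y)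
    (heig : ∀ q, Laplacian.laplacian F (sphVec b q) = -(lam * F (sphVec b q))) (θ : ℝ) :
    Real.sin θ ^ 2 * ∫ φ in (-Real.pi)..Real.pi, sphDeriv₂ b F (θ, φ) =
      -(lam * Real.sin θ ^ 2 * latitudeIntegral b F θ) -
        Real.sin θ * Real.cos θ * latitudeFlux b F θ := by
  set D : ℝ → ℝ := fun φ => fderiv ℝ F (sphVec b (θ, φ)) (Real.sin θ • sphVecPhi b (θ, φ)) with hD
  have hderiv : ∀ φ, HasDerivAt D (-(lam * Real.sin θ ^ 2) * F (sphVec b (θ, φ)) -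
      Real.sin θ ^ 2 * sphDeriv₂ b F (θ, φ) - Real.sin θ * Real.cos θ * sphDeriv b F (θ, φ)) φ := by
    intro φ
    refine (hasDerivAt_fderiv_comp_curve hF (sphVec_ne_zero b _) (hasDerivAt_sphVec_phi b θ φ)
      (hasDerivAt_sphVecPhi_phi b θ φ)).congr_deriv ?_
    have h1 := heig (θ, φ)
    rw [laplacian_eq_sum_sphFrame, fderiv_fderiv_apply_self_of_radial hF hrad (sphVec_ne_zero b _)]
      at h1
    have h2 := fderiv_apply_self_of_radial hF hrad (sphVec_ne_zero b (θ, φ))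
    simp only [map_smul, map_add, smul_apply, smul_eq_mul, h2]
    rw [sphDeriv₂, sphDeriv]
    linear_combination Real.sin θ ^ 2 * h1
  have hc : Continuous fun φ => (-(lam * Real.sin θ ^ 2) * F (sphVec b (θ, φ)) -
      Real.sin θ ^ 2 * sphDeriv₂ b F (θ, φ) - Real.sin θ * Real.cos θ * sphDeriv b F (θ, φ)) := by
    have hp : Continuous fun φ : ℝ => (θ, φ) := by fun_prop
    exact (((continuous_comp_sphVec b hF).comp hp).const_mul _ |>.sub
      (((continuous_sphDeriv₂ b hF).comp hp).const_mul _)).sub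
      (((continuous_sphDeriv b hF).comp hp).const_mul _)
  have hp : Continuous fun φ : ℝ => (θ, φ) := by fun_prop
  have h := intervalIntegral.integral_eq_sub_of_hasDerivAt (a := -Real.pi) (b := Real.pi)
    (fun φ _ => hderiv φ) (hc.intervalIntegrable _ _)
  have i1 : IntervalIntegrable (fun φ => -(lam * Real.sin θ ^ 2) * F (sphVec b (θ, φ))) volume
      (-Real.pi) Real.pi :=
    (((continuous_comp_sphVec b hF).comp hp).const_mul _).intervalIntegrable _ _
  have i2 : IntervalIntegrable (fun φ => Real.sin θ ^ 2 * sphDeriv₂ b F (θ, φ)) volume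
      (-Real.pi) Real.pi :=
    (((continuous_sphDeriv₂ b hF).comp hp).const_mul _).intervalIntegrable _ _
  have i3 : IntervalIntegrable (fun φ => Real.sin θ * Real.cos θ * sphDeriv b F (θ, φ)) volume
      (-Real.pi) Real.pi :=
    (((continuous_sphDeriv b hF).comp hp).const_mul _).intervalIntegrable _ _
  have hper : D Real.pi = D (-Real.pi) := by
    simp only [hD, sphVec, sphVecPhi, Real.cos_neg, Real.sin_neg, Real.sin_pi, neg_zero]
  rw [intervalIntegral.integral_sub (i1.sub i2) i3, intervalIntegral.integral_sub i1 i2,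
    intervalIntegral.integral_const_mul, intervalIntegral.integral_const_mul,
    intervalIntegral.integral_const_mul, hper, sub_self] at h
  rw [latitudeIntegral, latitudeFlux]
  linear_combination -h

/-- This is the equation in Sturm–Liouville form, `(sin θ M')' = -λ sin θ M` for the latitude
integral `M`, obtained by cancelling one factor `sin θ`. -/
theorem hasDerivAt_sin_mul_latitudeFlux (hF : ContDiffOn ℝ 2 F {0}ᶜ)
    (hrad : ∀ (c : ℝ) (y : E3), 0 < c → F (c • y) = F y)
    (heig : ∀ q, Laplacian.laplacian F (sphVec b q) = -(lam * F (sphVec b q))) {θ : ℝ}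
    (hθ : θ ∈ Set.Ioo 0 Real.pi) :
    HasDerivAt (fun θ => Real.sin θ * latitudeFlux b F θ)
      (-(lam * Real.sin θ * latitudeIntegral b F θ)) θ := by
  refine ((Real.hasDerivAt_sin θ).mul (hasDerivAt_latitudeFlux b hF hrad θ)).congr_deriv ?_
  have hs := (Real.sin_pos_of_pos_of_lt_pi hθ.1 hθ.2).ne'
  have := integral_sphDeriv₂ b hF hrad heig θ
  refine mul_left_cancel₀ hs ?_
  linear_combination this

theorem continuous_latitudeIntegral (hF : ContDiffOn ℝ 2 F {0}ᶜ) :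
    Continuous (latitudeIntegral b F) :=
  continuous_iff_continuousAt.2 fun θ => (hasDerivAt_latitudeIntegral b hF θ).continuousAt

theorem continuous_latitudeFlux (hF : ContDiffOn ℝ 2 F {0}ᶜ)
    (hrad : ∀ (c : ℝ) (y : E3), 0 < c → F (c • y) = F y) : Continuous (latitudeFlux b F) :=
  continuous_iff_continuousAt.2 fun θ => (hasDerivAt_latitudeFlux b hF hrad θ).continuousAt

theorem lam_mul_integral_latitudeIntegral (hF : ContDiffOn ℝ 2 F {0}ᶜ)
    (hrad : ∀ (c : ℝ) (y : E3), 0 < c → F (c • y) = F y)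
    (heig : ∀ q, Laplacian.laplacian F (sphVec b q) = -(lam * F (sphVec b q))) :
    lam * ∫ θ in (0 : ℝ)..Real.pi, Real.sin θ * latitudeIntegral b F θ = 0 := by
  have hc : Continuous fun θ => -(lam * Real.sin θ * latitudeIntegral b F θ) := by
    have := continuous_latitudeIntegral b hF
    fun_prop
  have h := intervalIntegral.integral_eq_sub_of_hasDerivAt_of_le Real.pi_pos.le
    (Real.continuous_sin.mul (continuous_latitudeFlux b hF hrad)).continuousOn
    (fun θ hθ => hasDerivAt_sin_mul_latitudeFlux b hF hrad heig hθ) (hc.intervalIntegrable _ _)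
  simp only [Pi.mul_apply, Real.sin_pi, Real.sin_zero, zero_mul, sub_self, intervalIntegral.integral_neg,
    mul_assoc, intervalIntegral.integral_const_mul, neg_eq_zero] at h
  exact h

/-- The continuous extension of `sin θ * log (2 sin (θ / 2))`. -/
def sinLog (θ : ℝ) : ℝ :=
  Real.cos (θ / 2) * ((2 * Real.sin (θ / 2)) * Real.log (2 * Real.sin (θ / 2)))

theorem continuous_sinLog : Continuous sinLog :=
  (by fun_prop : Continuous fun θ : ℝ => Real.cos (θ / 2)).mul
    (Real.continuous_mul_log.comp (by fun_prop : Continuous fun θ : ℝ => 2 * Real.sin (θ / 2)))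

theorem sinLog_eq (θ : ℝ) : sinLog θ = Real.sin θ * Real.log (2 * Real.sin (θ / 2)) := by
  have : Real.sin θ = 2 * Real.sin (θ / 2) * Real.cos (θ / 2) := by
    rw [← Real.sin_two_mul]; congr 1; ring
  rw [sinLog, this]; ring

/-- The factor `2 sin (θ / 2)` is the chordal distance to `b 2`, and `sin θ` times the derivative of
its logarithm is `(1 + cos θ) / 2`. Thus `-sinLog * M' + (1 + cos θ) M / 2` is an antiderivative of
the integrand. It vanishes at `π`, and at `0` only `M 0 = 2 π F (b 2)` survives. -/
theorem integral_latitudeIntegral_mul_sinLog (hF : ContDiffOn ℝ 2 F {0}ᶜ)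
    (hrad : ∀ (c : ℝ) (y : E3), 0 < c → F (c • y) = F y)
    (heig : ∀ q, Laplacian.laplacian F (sphVec b q) = -(lam * F (sphVec b q))) :
    lam * (∫ θ in (0 : ℝ)..Real.pi, sinLog θ * latitudeIntegral b F θ) -
      (∫ θ in (0 : ℝ)..Real.pi, Real.sin θ * latitudeIntegral b F θ) / 2 =
      -(2 * Real.pi * F (b 2)) := by
  have cm := continuous_latitudeIntegral b hF
  have cf := continuous_latitudeFlux b hF hrad
  have cl := continuous_sinLog
  have hc : Continuous fun θ => lam * (sinLog θ * latitudeIntegral b F θ) -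
      2⁻¹ * (Real.sin θ * latitudeIntegral b F θ) := by fun_prop
  have hΦ : Continuous fun θ => -(sinLog θ * latitudeFlux b F θ) +
      2⁻¹ * ((1 + Real.cos θ) * latitudeIntegral b F θ) := by fun_prop
  have hd : ∀ θ ∈ Set.Ioo 0 Real.pi, HasDerivAt (fun θ => -(sinLog θ * latitudeFlux b F θ) +
      2⁻¹ * ((1 + Real.cos θ) * latitudeIntegral b F θ))
      (lam * (sinLog θ * latitudeIntegral b F θ) -
        2⁻¹ * (Real.sin θ * latitudeIntegral b F θ)) θ := by
    intro θ hθ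
    have hs : 0 < Real.sin (θ / 2) :=
      Real.sin_pos_of_pos_of_lt_pi (by linarith [hθ.1]) (by linarith [hθ.1, hθ.2])
    have hlog : HasDerivAt (fun θ : ℝ => Real.log (2 * Real.sin (θ / 2)))
        (2 * (Real.cos (θ / 2) * (1 / 2)) / (2 * Real.sin (θ / 2))) θ :=
      ((((hasDerivAt_id θ).div_const 2).sin).const_mul 2).log (by simpa using hs.ne')
    have h1 := (hlog.mul (hasDerivAt_sin_mul_latitudeFlux b hF hrad heig hθ)).neg.add
      ((((Real.hasDerivAt_cos θ).const_add 1).mul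
        (hasDerivAt_latitudeIntegral b hF θ)).const_mul 2⁻¹)
    have e : (fun θ => -(sinLog θ * latitudeFlux b F θ) +
        2⁻¹ * ((1 + Real.cos θ) * latitudeIntegral b F θ)) =
        fun θ => -(Real.log (2 * Real.sin (θ / 2)) * (Real.sin θ * latitudeFlux b F θ)) +
        2⁻¹ * ((1 + Real.cos θ) * latitudeIntegral b F θ) := by
      funext θ; rw [sinLog_eq]; ring
    rw [e]
    refine HasDerivAt.congr_deriv h1 ?_
    rw [sinLog_eq]
    have e1 : Real.sin θ = 2 * Real.sin (θ / 2) * Real.cos (θ / 2) := by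
      rw [← Real.sin_two_mul]; congr 1; ring
    have e2 : Real.cos θ = 2 * Real.cos (θ / 2) ^ 2 - 1 := by
      rw [← Real.cos_two_mul]; congr 1; ring
    have e3 : 2 * (Real.cos (θ / 2) * (1 / 2)) / (2 * Real.sin (θ / 2)) * Real.sin θ =
        (1 + Real.cos θ) / 2 := by
      rw [e1, e2]; field_simp; ring
    linear_combination -latitudeFlux b F θ * e3
  have h := intervalIntegral.integral_eq_sub_of_hasDerivAt_of_le Real.pi_pos.le hΦ.continuousOn hd
    (hc.intervalIntegrable _ _)
  have h0 : latitudeIntegral b F 0 = 2 * Real.pi * F (b 2) := by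
    simp only [latitudeIntegral, sphVec, Real.sin_zero, Real.cos_zero, zero_mul, zero_smul,
      zero_add, one_smul, intervalIntegral.integral_const, smul_eq_mul]
    ring
  rw [intervalIntegral.integral_sub (Continuous.intervalIntegrable (by fun_prop) _ _)
    (Continuous.intervalIntegrable (by fun_prop) _ _), intervalIntegral.integral_const_mul,
    intervalIntegral.integral_const_mul, h0] at h
  have s0 : sinLog 0 = 0 := by simp [sinLog]
  have sp : sinLog Real.pi = 0 := by simp [sinLog]
  rw [s0, sp, Real.cos_pi, Real.cos_zero] at h
  linear_combination h

end SphericalMean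

theorem setIntegral_sphRect {h : ℝ × ℝ → ℝ} (hh : Continuous h) :
    IntegrableOn h sphRect ∧ ∫ q in sphRect, h q =
      ∫ θ in (0 : ℝ)..Real.pi, ∫ φ in (-Real.pi)..Real.pi, h (θ, φ) := by
  have hi : IntegrableOn h sphRect :=
    (hh.continuousOn.integrableOn_compact (isCompact_Icc.prod isCompact_Icc)).mono_set
      (Set.prod_mono Set.Ioo_subset_Icc_self Set.Ioo_subset_Icc_self)
  refine ⟨hi, ?_⟩
  have hpi : -Real.pi ≤ Real.pi := by linarith [Real.pi_pos]
  rw [sphRect, Measure.volume_eq_prod, setIntegral_prod _ (by simpa [Measure.volume_eq_prod, sphRect] using hi),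
    intervalIntegral.integral_of_le Real.pi_pos.le, integral_Ioc_eq_integral_Ioo]
  refine setIntegral_congr_fun measurableSet_Ioo fun θ _ => ?_
  rw [intervalIntegral.integral_of_le hpi, integral_Ioc_eq_integral_Ioo]

theorem IsEigenfunction.continuous {lam : ℝ} {Y : S2 → ℝ} (hY : IsEigenfunction lam Y) :
    Continuous Y := by
  have : Y = fun x : S2 => radialExtension Y x := funext fun x => (radialExtension_coe Y x).symm
  rw [this]
  exact hY.1.continuousOn.comp_continuous continuous_subtype_val fun x =>
    norm_ne_zero_iff.1 (by rw [norm_eq_of_mem_sphere]; exact one_ne_zero)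

theorem norm_sphVec_sub (b : OrthonormalBasis (Fin 3) ℝ E3) {q : ℝ × ℝ} (hq : q ∈ sphRect) :
    ‖sphVec b q - b 2‖ = 2 * Real.sin (q.1 / 2) := by
  have hs : 0 ≤ Real.sin (q.1 / 2) :=
    (Real.sin_pos_of_pos_of_lt_pi (by linarith [hq.1.1]) (by linarith [hq.1.1, hq.1.2])).le
  rw [← sq_eq_sq₀ (norm_nonneg _) (by positivity)]
  have e : sphVec b q - b 2 = (Real.sin q.1 * Real.cos q.2) • b 0 +
      (Real.sin q.1 * Real.sin q.2) • b 1 + (Real.cos q.1 - 1) • b 2 := by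
    rw [sphVec]; module
  rw [e, ← real_inner_self_eq_norm_sq, inner_frame]
  have e2 : Real.cos q.1 = 1 - 2 * Real.sin (q.1 / 2) ^ 2 := by
    have := Real.cos_two_mul' (q.1 / 2)
    have h3 := Real.sin_sq_add_cos_sq (q.1 / 2)
    rw [mul_div_cancel₀ _ two_ne_zero] at this
    linarith
  have h1 := Real.sin_sq_add_cos_sq q.1
  have h2 := Real.sin_sq_add_cos_sq q.2
  linear_combination Real.sin q.1 ^ 2 * h2 + h1 - 2 * e2

theorem measurable_log_norm_sub (x₀ : S2) :
    Measurable fun x : S2 => Real.log ‖(x : E3) - x₀‖ := by fun_prop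

theorem sin_mul_log_sphPoint (Y : S2 → ℝ) (b : OrthonormalBasis (Fin 3) ℝ E3) {x₀ : S2}
    (hb : b 2 = x₀) {q : ℝ × ℝ} (hq : q ∈ sphRect) :
    Real.sin q.1 * (Y (sphPoint b q) * Real.log ‖(sphPoint b q : E3) - x₀‖) =
      sinLog q.1 * radialExtension Y (sphVec b q) := by
  rw [← hb, ← radialExtension_coe Y (sphPoint b q), sinLog_eq]
  change _ * (radialExtension Y (sphVec b q) * Real.log ‖sphVec b q - b 2‖) = _
  rw [norm_sphVec_sub b hq]
  ring

section Eigenfunction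

variable {lam : ℝ} {Y : S2 → ℝ} (hY : IsEigenfunction lam Y)

include hY

theorem IsEigenfunction.laplacian_sphVec (b : OrthonormalBasis (Fin 3) ℝ E3) (q : ℝ × ℝ) :
    Laplacian.laplacian (radialExtension Y) (sphVec b q) =
      -(lam * radialExtension Y (sphVec b q)) := by
  have h := hY.2 (sphPoint b q)
  rw [← radialExtension_coe Y, sphereLaplacian, neg_eq_iff_eq_neg] at h
  exact h

theorem IsEigenfunction.integral_eq (b : OrthonormalBasis (Fin 3) ℝ E3) :
    ∫ x, Y x ∂vol = (4 * Real.pi)⁻¹ *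
      ∫ θ in (0 : ℝ)..Real.pi, Real.sin θ * latitudeIntegral b (radialExtension Y) θ := by
  have hc := continuous_comp_sphVec b hY.1
  rw [integral_vol_eq b hY.continuous.aestronglyMeasurable]
  have e : ∀ q : ℝ × ℝ, Real.sin q.1 / (4 * Real.pi) * Y (sphPoint b q) =
      (4 * Real.pi)⁻¹ * (Real.sin q.1 * radialExtension Y (sphVec b q)) := by
    intro q
    rw [← radialExtension_coe Y (sphPoint b q)]
    change _ * radialExtension Y (sphVec b q) = _
    ring
  simp_rw [e]
  rw [integral_const_mul, (setIntegral_sphRect (h := fun q =>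
    Real.sin q.1 * radialExtension Y (sphVec b q)) (by fun_prop)).2]
  simp_rw [intervalIntegral.integral_const_mul]
  rfl

/-- The product form also covers `λ = 0`. It is what makes additive constants in logarithmic
potentials harmless. -/
theorem IsEigenfunction.lam_mul_integral : lam * ∫ x, Y x ∂vol = 0 := by
  obtain ⟨b, -⟩ := exists_orthonormalBasis_two northPole
  rw [hY.integral_eq b, mul_left_comm, lam_mul_integral_latitudeIntegral b hY.1
    (fun c y hc => radialExtension_smul Y hc y) (hY.laplacian_sphVec b), mul_zero]

theorem IsEigenfunction.aestronglyMeasurable_mul_log (x₀ : S2) :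
    AEStronglyMeasurable (fun x : S2 => Y x * Real.log ‖(x : E3) - x₀‖) vol :=
  (hY.continuous.measurable.mul (measurable_log_norm_sub x₀)).aestronglyMeasurable

theorem IsEigenfunction.integrable_mul_log (x₀ : S2) :
    Integrable (fun x : S2 => Y x * Real.log ‖(x : E3) - x₀‖) vol := by
  obtain ⟨b, hb⟩ := exists_orthonormalBasis_two x₀
  have hc := continuous_comp_sphVec b hY.1
  have hl := continuous_sinLog
  rw [integrable_vol_iff b (hY.aestronglyMeasurable_mul_log x₀)]
  refine ((setIntegral_sphRect (h := fun q => (4 * Real.pi)⁻¹ *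
    (sinLog q.1 * radialExtension Y (sphVec b q))) (by fun_prop)).1).congr_fun
    (fun q hq => ?_) measurableSet_sphRect
  simp only
  rw [← sin_mul_log_sphPoint Y b hb hq]
  ring

/-- **Green's formula** for an eigenfunction of the Laplacian of the sphere. -/
theorem IsEigenfunction.eq_integral_sub (x₀ : S2) :
    Y x₀ = ∫ x, Y x ∂vol - 2 * lam * ∫ x, Y x * Real.log ‖(x : E3) - x₀‖ ∂vol := by
  obtain ⟨b, hb⟩ := exists_orthonormalBasis_two x₀
  have hc := continuous_comp_sphVec b hY.1
  have hl := continuous_sinLog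
  have h := integral_latitudeIntegral_mul_sinLog b hY.1
    (fun c y hc => radialExtension_smul Y hc y) (hY.laplacian_sphVec b)
  have h1 : ∫ x, Y x * Real.log ‖(x : E3) - x₀‖ ∂vol = (4 * Real.pi)⁻¹ *
      ∫ θ in (0 : ℝ)..Real.pi, sinLog θ * latitudeIntegral b (radialExtension Y) θ := by
    rw [integral_vol_eq b (hY.aestronglyMeasurable_mul_log x₀)]
    rw [setIntegral_congr_fun (g := fun q => (4 * Real.pi)⁻¹ *
      (sinLog q.1 * radialExtension Y (sphVec b q))) measurableSet_sphRect, integral_const_mul,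
      (setIntegral_sphRect (h := fun q => sinLog q.1 * radialExtension Y (sphVec b q))
        (by fun_prop)).2]
    · simp_rw [intervalIntegral.integral_const_mul]
      rfl
    · intro q hq
      simp only
      rw [← sin_mul_log_sphPoint Y b hb hq]
      ring
  rw [h1, hY.integral_eq b, ← radialExtension_coe Y x₀, ← hb]
  have := Real.pi_pos.ne'
  field_simp
  linear_combination 2 * h

end Eigenfunction

/-- By Archimedes, `(1 + cos θ) / 2` is uniformly distributed on `[0, 1]`, so this is `∫₀¹ u^N du`.
-/
theorem integral_inner_pow (N : ℕ) (x₀ : S2) :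
    ∫ x : S2, ((1 + inner ℝ (x : E3) x₀) / 2) ^ N ∂vol = 1 / (N + 1) := by
  obtain ⟨b, hb⟩ := exists_orthonormalBasis_two x₀
  have hm : Continuous fun x : S2 => ((1 + inner ℝ (x : E3) x₀) / 2) ^ N := by fun_prop
  rw [integral_vol_eq b hm.aestronglyMeasurable]
  have e : ∀ q : ℝ × ℝ, Real.sin q.1 / (4 * Real.pi) *
      ((1 + inner ℝ (sphPoint b q : E3) x₀) / 2) ^ N =
      (4 * Real.pi)⁻¹ * (Real.sin q.1 * ((1 + Real.cos q.1) / 2) ^ N) := by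
    intro q
    have : inner ℝ (sphPoint b q : E3) x₀ = Real.cos q.1 := by
      have h0 : (x₀ : E3) = (0 : ℝ) • b 0 + (0 : ℝ) • b 1 + (1 : ℝ) • b 2 := by
        rw [← hb]; module
      rw [h0]
      change inner ℝ (sphVec b q) _ = _
      rw [sphVec, inner_frame]
      ring
    rw [this]
    ring
  simp_rw [e]
  rw [integral_const_mul, (setIntegral_sphRect (h := fun q =>
    Real.sin q.1 * ((1 + Real.cos q.1) / 2) ^ N) (by fun_prop)).2]
  simp_rw [intervalIntegral.integral_const]
  have hN : (N : ℝ) + 1 ≠ 0 := by positivity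
  have hd : ∀ θ ∈ Set.uIcc 0 Real.pi, HasDerivAt
      (fun θ => -(4 * Real.pi) * ((1 + Real.cos θ) / 2) ^ (N + 1) / (N + 1))
      ((Real.pi - -Real.pi) • (Real.sin θ * ((1 + Real.cos θ) / 2) ^ N)) θ := by
    intro θ _
    have := (((((Real.hasDerivAt_cos θ).const_add 1).div_const 2).pow (N + 1)).const_mul
      (-(4 * Real.pi))).div_const ((N : ℝ) + 1)
    refine HasDerivAt.congr_deriv this ?_
    simp only [Nat.add_sub_cancel, smul_eq_mul]
    push_cast
    field_simp
    ring
  rw [intervalIntegral.integral_eq_sub_of_hasDerivAt hd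
    (Continuous.intervalIntegrable (by fun_prop) _ _)]
  have := Real.pi_pos.ne'
  simp
  field_simp

/-! ### Stereographic projection and the Gaussian analytic function -/

/-- In a frame with axis `x`, the open rectangle of spherical coordinates never reaches `x`. -/
theorem vol_singleton (x : S2) : vol {x} = 0 := by
  obtain ⟨b, hb⟩ := exists_orthonormalBasis_two x
  rw [← (measurePreserving_sphPoint b).measure_preimage (measurableSet_singleton x).nullMeasurableSet,
    sphMeasure]
  refine (withDensity_absolutelyContinuous _ _) ?_
  rw [Measure.restrict_apply' measurableSet_sphRect]
  refine (congrArg _ (Set.eq_empty_of_forall_notMem fun q hq => ?_)).trans measure_empty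
  have h1 : sphVec b q = b 2 := by rw [hb]; exact congrArg Subtype.val hq.1
  have h2 := norm_sphVec_sub b hq.2
  rw [h1, sub_self, norm_zero] at h2
  have hs : 0 < Real.sin (q.1 / 2) := Real.sin_pos_of_pos_of_lt_pi
    (by linarith [hq.2.1.1]) (by linarith [hq.2.1.1, hq.2.1.2])
  linarith

theorem ae_ne_of_finite {s : Set S2} (hs : s.Finite) : ∀ᵐ x ∂vol, x ∉ s := by
  rw [ae_iff]
  simp only [not_not]
  exact (measure_biUnion_null_iff hs.countable).2 (fun x _ => vol_singleton x) |> fun h => by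
    simpa using h

/-- Stereographic projection from the north pole. -/
def stereoInv (x : S2) : ℂ := (⟨(x : E3) 0, (x : E3) 1⟩ : ℂ) / ((1 - (x : E3) 2 : ℝ) : ℂ)

theorem measurable_stereoInv : Measurable stereoInv := by
  have h1 : Measurable fun x : S2 => (⟨(x : E3) 0, (x : E3) 1⟩ : ℂ) :=
    Complex.measurableEquivRealProd.symm.measurable.comp
      (by fun_prop : Measurable fun x : S2 => ((x : E3) 0, (x : E3) 1))
  exact h1.div (by fun_prop)

theorem sum_sq_coord (x : S2) : (x : E3) 0 ^ 2 + (x : E3) 1 ^ 2 + (x : E3) 2 ^ 2 = 1 := by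
  have h : ‖(x : E3)‖ ^ 2 = 1 := by rw [norm_eq_of_mem_sphere x, one_pow]
  rw [EuclideanSpace.norm_sq_eq, Fin.sum_univ_three] at h
  simpa using h

theorem stereo_stereoInv {x : S2} (hx : x ≠ northPole) : stereo (stereoInv x) = x := by
  have h := sum_sq_coord x
  have h2 : (x : E3) 2 < 1 := by
    by_contra hge
    have h2 : (x : E3) 2 = 1 := by nlinarith [sq_nonneg ((x : E3) 0), sq_nonneg ((x : E3) 1)]
    have h0 : (x : E3) 0 = 0 := by
      have : (x : E3) 0 ^ 2 = 0 := by nlinarith [sq_nonneg ((x : E3) 0), sq_nonneg ((x : E3) 1)]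
      simpa using this
    have h1 : (x : E3) 1 = 0 := by
      have : (x : E3) 1 ^ 2 = 0 := by nlinarith [sq_nonneg ((x : E3) 0), sq_nonneg ((x : E3) 1)]
      simpa using this
    refine hx (Subtype.ext ?_)
    ext i
    fin_cases i
    · simpa [northPole] using h0
    · simpa [northPole] using h1
    · simpa [northPole] using h2
  have hd : 1 - (x : E3) 2 ≠ 0 := by linarith
  have hre : (stereoInv x).re = (x : E3) 0 / (1 - (x : E3) 2) := by
    rw [stereoInv, Complex.div_ofReal_re]
  have him : (stereoInv x).im = (x : E3) 1 / (1 - (x : E3) 2) := by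
    rw [stereoInv, Complex.div_ofReal_im]
  have hz : ‖stereoInv x‖ ^ 2 = (1 + (x : E3) 2) / (1 - (x : E3) 2) := by
    rw [Complex.sq_norm, Complex.normSq_apply, hre, him]
    field_simp
    linear_combination h
  refine Subtype.ext ?_
  ext i
  simp only [stereo, hre, him, hz]
  fin_cases i
  · simp; field_simp; ring
  · simp; field_simp; ring
  · simp; field_simp; ring

theorem norm_stereo_sub_stereo_sq (z w : ℂ) : ‖(stereo z : E3) - stereo w‖ ^ 2 =
    4 * ‖z - w‖ ^ 2 / ((1 + ‖z‖ ^ 2) * (1 + ‖w‖ ^ 2)) := by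
  have h1 : 1 + ‖z‖ ^ 2 ≠ 0 := by positivity
  have h2 : 1 + ‖w‖ ^ 2 ≠ 0 := by positivity
  rw [EuclideanSpace.norm_sq_eq, Fin.sum_univ_three]
  simp only [stereo, PiLp.sub_apply, PiLp.smul_apply, smul_eq_mul, Real.norm_eq_abs, sq_abs,
    Matrix.cons_val_zero, Matrix.cons_val_one, Matrix.cons_val]
  field_simp
  simp only [Complex.sq_norm, Complex.normSq_apply, Complex.sub_re, Complex.sub_im]
  ring

theorem norm_stereo_sub_northPole_sq (z : ℂ) : ‖(stereo z : E3) - northPole‖ ^ 2 =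
    4 / (1 + ‖z‖ ^ 2) := by
  have h1 : 1 + ‖z‖ ^ 2 ≠ 0 := by positivity
  rw [EuclideanSpace.norm_sq_eq, Fin.sum_univ_three]
  simp only [stereo, northPole, PiLp.sub_apply, PiLp.smul_apply, smul_eq_mul, Real.norm_eq_abs,
    sq_abs, Matrix.cons_val_zero, Matrix.cons_val_one, Matrix.cons_val]
  simp
  field_simp
  simp only [Complex.sq_norm, Complex.normSq_apply]
  ring

theorem one_add_inner_stereo (z w : ℂ) : (1 + inner ℝ (stereo z : E3) (stereo w)) / 2 =
    ‖1 + starRingEnd ℂ z * w‖ ^ 2 / ((1 + ‖z‖ ^ 2) * (1 + ‖w‖ ^ 2)) := by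
  have h1 : 1 + ‖z‖ ^ 2 ≠ 0 := by positivity
  have h2 : 1 + ‖w‖ ^ 2 ≠ 0 := by positivity
  rw [PiLp.inner_apply, Fin.sum_univ_three]
  simp only [stereo, PiLp.smul_apply, smul_eq_mul,
    Matrix.cons_val_zero, Matrix.cons_val_one, Matrix.cons_val]
  simp
  field_simp
  simp only [Complex.sq_norm, Complex.normSq_apply]
  simp
  ring

theorem log_norm_stereo_sub_stereo {z w : ℂ} (h : z ≠ w) :
    Real.log ‖(stereo z : E3) - stereo w‖ = Real.log ‖z - w‖ + Real.log 2 -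
      Real.log (1 + ‖z‖ ^ 2) / 2 - Real.log (1 + ‖w‖ ^ 2) / 2 := by
  have h0 : ‖z - w‖ ≠ 0 := norm_ne_zero_iff.2 (sub_ne_zero.2 h)
  have h1 : 1 + ‖z‖ ^ 2 ≠ 0 := by positivity
  have h2 : 1 + ‖w‖ ^ 2 ≠ 0 := by positivity
  have h4 : (4 : ℝ) = 2 ^ 2 := by norm_num
  have := congrArg Real.log (norm_stereo_sub_stereo_sq z w)
  rw [Real.log_pow, Real.log_div (by positivity) (by positivity), Real.log_mul (by norm_num)
    (by positivity), Real.log_mul h1 h2, Real.log_pow, h4, Real.log_pow] at this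
  push_cast at this
  linarith

theorem log_norm_stereo_sub_northPole (z : ℂ) :
    Real.log ‖(stereo z : E3) - northPole‖ = Real.log 2 - Real.log (1 + ‖z‖ ^ 2) / 2 := by
  have h1 : 1 + ‖z‖ ^ 2 ≠ 0 := by positivity
  have h4 : (4 : ℝ) = 2 ^ 2 := by norm_num
  have := congrArg Real.log (norm_stereo_sub_northPole_sq z)
  rw [Real.log_pow, Real.log_div (by norm_num) h1, h4, Real.log_pow] at this
  push_cast at this
  linarith

/-- The coefficients of `a` in the normalized function `f_N(z) / (1 + |z|²)^(N/2)`, where `z` is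
the stereographic projection of `x`. -/
def gafCoeff (N : ℕ) (x : S2) (n : Fin (N + 1)) : ℂ :=
  ((Real.sqrt (N.choose n) / Real.sqrt (1 + ‖stereoInv x‖ ^ 2) ^ N : ℝ) : ℂ) * stereoInv x ^ (n : ℕ)

/-- The normalized Gaussian analytic function, as a function on the sphere. -/
def normalizedGaf (N : ℕ) (a : Fin (N + 1) → ℂ) (x : S2) : ℂ := ∑ n, a n * gafCoeff N x n

theorem measurable_gafCoeff (N : ℕ) (n : Fin (N + 1)) : Measurable fun x => gafCoeff N x n := by
  have := measurable_stereoInv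
  unfold gafCoeff
  fun_prop

theorem normalizedGaf_eq (N : ℕ) (a : Fin (N + 1) → ℂ) (x : S2) :
    normalizedGaf N a x = (gaf N a).eval (stereoInv x) /
      ((Real.sqrt (1 + ‖stereoInv x‖ ^ 2) ^ N : ℝ) : ℂ) := by
  simp only [normalizedGaf, gaf, Polynomial.eval_finsetSum, Polynomial.eval_monomial,
    Finset.sum_div, gafCoeff]
  refine Finset.sum_congr rfl fun n _ => ?_
  push_cast
  ring

/-! ### The covariance kernel of the normalized function -/

theorem sum_choose_mul_pow {R : Type*} [CommRing R] (N : ℕ) (t : R) :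
    ∑ n : Fin (N + 1), (N.choose n : R) * t ^ (n : ℕ) = (1 + t) ^ N := by
  rw [add_comm 1 t, add_pow, Finset.sum_range]
  refine Finset.sum_congr rfl fun n _ => ?_
  rw [one_pow]; ring

theorem sum_conj_gafCoeff_mul (N : ℕ) (x y : S2) :
    ∑ n, starRingEnd ℂ (gafCoeff N x n) * gafCoeff N y n =
      (1 + starRingEnd ℂ (stereoInv x) * stereoInv y) ^ N /
      (((Real.sqrt (1 + ‖stereoInv x‖ ^ 2) * Real.sqrt (1 + ‖stereoInv y‖ ^ 2)) ^ N : ℝ) : ℂ) := by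
  rw [← sum_choose_mul_pow, Finset.sum_div]
  refine Finset.sum_congr rfl fun n _ => ?_
  have h : ((Real.sqrt (N.choose n) : ℝ) : ℂ) * (Real.sqrt (N.choose n) : ℝ) = N.choose n := by
    rw [← Complex.ofReal_mul, Real.mul_self_sqrt (by positivity), Complex.ofReal_natCast]
  simp only [gafCoeff, map_mul, map_pow, Complex.conj_ofReal]
  push_cast
  rw [← h]
  ring

theorem norm_sum_conj_gafCoeff_sq (N : ℕ) {x y : S2} (hx : x ≠ northPole) (hy : y ≠ northPole) :
    ‖∑ n, starRingEnd ℂ (gafCoeff N x n) * gafCoeff N y n‖ ^ 2 =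
      ((1 + inner ℝ (x : E3) y) / 2) ^ N := by
  have h := one_add_inner_stereo (stereoInv x) (stereoInv y)
  rw [stereo_stereoInv hx, stereo_stereoInv hy] at h
  rw [sum_conj_gafCoeff_mul, h, norm_div, norm_pow, Complex.norm_real, Real.norm_of_nonneg
    (by positivity), ← div_pow, ← pow_mul, mul_comm N, pow_mul, div_pow, mul_pow,
    Real.sq_sqrt (by positivity), Real.sq_sqrt (by positivity)]

/-- No point is excluded: at `northPole` the default value of `stereoInv` still yields a unit
vector. Hence the normalized function is standard Gaussian everywhere, and only covariances avoid
the pole. -/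
theorem sum_norm_gafCoeff_sq (N : ℕ) (x : S2) : ∑ n, ‖gafCoeff N x n‖ ^ 2 = 1 := by
  have h := sum_conj_gafCoeff_mul N x x
  have h1 : (0 : ℝ) < 1 + ‖stereoInv x‖ ^ 2 := by positivity
  rw [Real.mul_self_sqrt h1.le] at h
  simp_rw [Complex.conj_mul'] at h
  rw [← Complex.ofReal_inj]
  push_cast
  rw [h]
  push_cast
  have : (1 + (‖stereoInv x‖ : ℂ) ^ 2) ^ N ≠ 0 := by exact_mod_cast (pow_pos h1 N).ne'
  exact div_self this

/-! ### Zeros of the polynomial and their logarithmic potential -/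

theorem gaf_coeff (N : ℕ) (a : Fin (N + 1) → ℂ) (m : Fin (N + 1)) :
    (gaf N a).coeff m = a m * ((Real.sqrt (N.choose m) : ℝ) : ℂ) := by
  simp only [gaf, Polynomial.finsetSum_coeff, Polynomial.coeff_monomial, Fin.val_inj]
  simp

theorem gaf_ne_zero {N : ℕ} {a : Fin (N + 1) → ℂ} (ha : a 0 ≠ 0) : gaf N a ≠ 0 := by
  intro h
  have := gaf_coeff N a 0
  rw [h] at this
  simp at this
  exact ha this.symm

theorem natDegree_gaf_le (N : ℕ) (a : Fin (N + 1) → ℂ) : (gaf N a).natDegree ≤ N := by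
  refine Polynomial.natDegree_sum_le_of_forall_le _ _ fun n _ => ?_
  exact (Polynomial.natDegree_monomial_le _).trans (Nat.lt_succ_iff.1 n.2)

theorem card_roots_gaf (N : ℕ) (a : Fin (N + 1) → ℂ) :
    (gaf N a).roots.card = (gaf N a).natDegree :=
  (IsAlgClosed.splits (gaf N a)).natDegree_eq_card_roots.symm

/-- The zero polynomial is included: it has no roots and `natDegree` zero, so all `N` points sit at
the north pole. -/
theorem card_zerosOnSphere (N : ℕ) (a : Fin (N + 1) → ℂ) : (zerosOnSphere N a).card = N := by
  rw [zerosOnSphere, Multiset.card_add, Multiset.card_map, Multiset.card_replicate, card_roots_gaf,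
    Nat.add_sub_cancel' (natDegree_gaf_le N a)]

/-- The logarithmic potential at `x` of a multiset of points of the sphere. -/
def logPotential (s : Multiset S2) (x : S2) : ℝ :=
  (s.map fun y : S2 => Real.log ‖(x : E3) - y‖).sum

/-- Each factor `z - w` is a chordal distance times `√(1 + ‖z‖²)` and a quantity independent of `z`.
The constant is left unspecified because `λ ∫ Y = 0` removes it. -/
theorem exists_log_norm_prod_eq (R : Multiset ℂ) : ∃ C : ℝ, ∀ z, z ∉ R →
    Real.log ‖(R.map fun w => z - w).prod‖ = logPotential (R.map stereo) (stereo z) +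
      R.card * (Real.log (1 + ‖z‖ ^ 2) / 2) + C := by
  induction R using Multiset.induction with
  | empty => exact ⟨0, fun z _ => by simp [logPotential]⟩
  | cons w R ih =>
    obtain ⟨C, hC⟩ := ih
    refine ⟨C - Real.log 2 + Real.log (1 + ‖w‖ ^ 2) / 2, fun z hz => ?_⟩
    rw [Multiset.mem_cons, not_or] at hz
    have hp : (R.map fun w => z - w).prod ≠ 0 := by
      rw [ne_eq, Multiset.prod_eq_zero_iff]
      intro h
      obtain ⟨v, hv, hv0⟩ := Multiset.mem_map.1 h
      exact hz.2 (sub_eq_zero.1 hv0 ▸ hv)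
    have h1 := hC z hz.2
    have h2 := log_norm_stereo_sub_stereo hz.1
    rw [Multiset.map_cons, Multiset.prod_cons, norm_mul, Real.log_mul
      (norm_ne_zero_iff.2 (sub_ne_zero.2 hz.1)) (norm_ne_zero_iff.2 hp), h1, Multiset.card_cons]
    simp only [logPotential, Multiset.map_cons, Multiset.sum_cons]
    push_cast
    linarith

/-- A finite zero contributes `log (1 + ‖z‖²) / 2` beyond its chordal logarithm, while a zero at
infinity has the potential `log 2 - log (1 + ‖z‖²) / 2`. With `N` zeros in all, these weights
exactly balance the normalization of degree `N`. -/
theorem exists_log_norm_normalizedGaf_eq {N : ℕ} {a : Fin (N + 1) → ℂ} (ha : gaf N a ≠ 0) :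
    ∃ C : ℝ, ∀ᵐ x ∂vol, Real.log ‖normalizedGaf N a x‖ =
      logPotential (zerosOnSphere N a) x + C := by
  obtain ⟨C, hC⟩ := exists_log_norm_prod_eq (gaf N a).roots
  refine ⟨Real.log ‖(gaf N a).leadingCoeff‖ + C - (N - (gaf N a).natDegree : ℕ) * Real.log 2, ?_⟩
  filter_upwards [ae_ne_of_finite (Set.finite_singleton northPole),
    ae_ne_of_finite (Multiset.finite_toSet (zerosOnSphere N a))] with x hx hz
  have hst := stereo_stereoInv hx
  have hr : stereoInv x ∉ (gaf N a).roots := by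
    intro h
    refine hz ?_
    rw [zerosOnSphere, Multiset.mem_add]
    exact Or.inl (Multiset.mem_map.2 ⟨_, h, hst⟩)
  have h0 : (gaf N a).eval (stereoInv x) ≠ 0 := fun h =>
    hr ((Polynomial.mem_roots ha).2 h)
  have h1 : (0 : ℝ) < 1 + ‖stereoInv x‖ ^ 2 := by positivity
  have he := (IsAlgClosed.splits (gaf N a)).eval_eq_prod_roots (stereoInv x)
  have hl := Polynomial.leadingCoeff_ne_zero.2 ha
  have hp : ((gaf N a).roots.map fun w => stereoInv x - w).prod ≠ 0 := by
    intro h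
    rw [h, mul_zero] at he
    exact h0 he
  have hC' := hC _ hr
  rw [hst, card_roots_gaf] at hC'
  have hN := log_norm_stereo_sub_northPole (stereoInv x)
  rw [hst] at hN
  have hcast : ((N - (gaf N a).natDegree : ℕ) : ℝ) = N - (gaf N a).natDegree :=
    Nat.cast_sub (natDegree_gaf_le N a)
  rw [normalizedGaf_eq, norm_div, Complex.norm_real, Real.norm_of_nonneg (by positivity),
    Real.log_div (norm_ne_zero_iff.2 h0) (by positivity), Real.log_pow, Real.log_sqrt h1.le, he,
    norm_mul, Real.log_mul (norm_ne_zero_iff.2 hl) (norm_ne_zero_iff.2 hp), hC']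
  simp only [zerosOnSphere, logPotential, Multiset.map_add, Multiset.sum_add,
    Multiset.map_replicate, Multiset.sum_replicate, nsmul_eq_mul, hN, hcast]
  ring

theorem IsEigenfunction.sum_map_eq {lam : ℝ} {Y : S2 → ℝ} (hY : IsEigenfunction lam Y)
    (s : Multiset S2) :
    Integrable (fun x => Y x * logPotential s x) vol ∧
    (s.map Y).sum = s.card * ∫ x, Y x ∂vol - 2 * lam * ∫ x, Y x * logPotential s x ∂vol := by
  induction s using Multiset.induction with
  | empty => simp [logPotential]
  | cons y s ih =>
    have e : (fun x => Y x * logPotential (y ::ₘ s) x) =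
        fun x => Y x * Real.log ‖(x : E3) - y‖ + Y x * logPotential s x := by
      funext x
      simp only [logPotential, Multiset.map_cons, Multiset.sum_cons]
      ring
    have hi := hY.integrable_mul_log y
    refine ⟨e ▸ hi.add ih.1, ?_⟩
    rw [e, integral_add hi ih.1, Multiset.map_cons, Multiset.sum_cons, ih.2,
      hY.eq_integral_sub y, Multiset.card_cons]
    push_cast
    ring

theorem IsEigenfunction.integrable {lam : ℝ} {Y : S2 → ℝ} (hY : IsEigenfunction lam Y) :
    Integrable Y vol := by
  have hc := hY.continuous
  obtain ⟨C, hC⟩ := isCompact_univ.exists_bound_of_continuousOn hc.continuousOn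
  exact Integrable.of_bound hc.aestronglyMeasurable C
    (Filter.Eventually.of_forall fun x => hC x trivial)

/-- The linear statistic as an integral against the logarithm of the normalized function. -/
theorem IsEigenfunction.linearStatistic_eq {lam : ℝ} {Y : S2 → ℝ} (hY : IsEigenfunction lam Y)
    {N : ℕ} {a : Fin (N + 1) → ℂ} (ha : gaf N a ≠ 0) (c : ℝ) :
    linearStatistic N Y a = N * ∫ x, Y x ∂vol -
      lam * ∫ x, Y x * (Real.log (‖normalizedGaf N a x‖ ^ 2) + c) ∂vol := by
  obtain ⟨C, hC⟩ := exists_log_norm_normalizedGaf_eq ha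
  obtain ⟨hi, hs⟩ := hY.sum_map_eq (zerosOnSphere N a)
  have e : ∫ x, Y x * (Real.log (‖normalizedGaf N a x‖ ^ 2) + c) ∂vol =
      ∫ x, (2 * (Y x * logPotential (zerosOnSphere N a) x) + (2 * C + c) * Y x) ∂vol := by
    refine integral_congr_ae (hC.mono fun x hx => ?_)
    simp only
    rw [Real.log_pow, hx]
    push_cast
    ring
  rw [linearStatistic, hs, card_zerosOnSphere, e, integral_add (hi.const_mul 2)
    (hY.integrable.const_mul _), integral_const_mul, integral_const_mul]
  -- Both the constant of the potential and the free shift `c` multiply `λ ∫ Y = 0`.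
  linear_combination (2 * C + c) * hY.lam_mul_integral

/-! ### The variance of linear statistics -/

theorem inner_pow_mem_unitInterval (N : ℕ) (x y : S2) :
    0 ≤ ((1 + inner ℝ (x : E3) y) / 2) ^ N ∧ ((1 + inner ℝ (x : E3) y) / 2) ^ N ≤ 1 := by
  have h := abs_le.1 (abs_real_inner_le_norm (x : E3) (y : E3))
  rw [norm_eq_of_mem_sphere, norm_eq_of_mem_sphere, one_mul] at h
  have h0 : 0 ≤ (1 + inner ℝ (x : E3) y) / 2 := by linarith [h.1]
  exact ⟨pow_nonneg h0 N, pow_le_one₀ h0 (by linarith [h.2])⟩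

theorem ae_ne_zero_standardComplexGaussian : ∀ᵐ z ∂standardComplexGaussian, z ≠ 0 := by
  rw [standardComplexGaussian_eq_withDensity]
  exact (withDensity_absolutelyContinuous _ _).ae_le (Measure.ae_ne volume 0)

/-- The second moment of the centered logarithm of a standard complex Gaussian. -/
def logSecondMoment : ℝ := ∫ z, (Real.log (‖z‖ ^ 2) + logCenter) ^ 2 ∂standardComplexGaussian

variable {Ω : Type*} [MeasurableSpace Ω] {P : Measure Ω} {N : ℕ}
  {a : Fin (N + 1) → Ω → ℂ}

/-- The centered logarithm of the squared modulus of the normalized Gaussian analytic function. -/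
def centeredLog (a : Fin (N + 1) → Ω → ℂ) (ω : Ω) (x : S2) : ℝ :=
  Real.log (‖normalizedGaf N (fun n => a n ω) x‖ ^ 2) + logCenter

theorem ae_ne_zero_of_hasLaw {ζ : Ω → ℂ} (hζ : HasLaw ζ standardComplexGaussian P) :
    ∀ᵐ ω ∂P, ζ ω ≠ 0 := by
  have h := ae_ne_zero_standardComplexGaussian
  rw [← hζ.map_eq] at h
  exact ae_of_ae_map hζ.aemeasurable h

theorem memLp_log_of_hasLaw {ζ : Ω → ℂ} (hζ : HasLaw ζ standardComplexGaussian P) :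
    MemLp (fun ω => Real.log (‖ζ ω‖ ^ 2)) 2 P := by
  have hm : Measurable fun z : ℂ => Real.log (‖z‖ ^ 2) := by fun_prop
  have h : MemLp (fun z : ℂ => Real.log (‖z‖ ^ 2)) 2 standardComplexGaussian :=
    (memLp_two_iff_integrable_sq hm.aestronglyMeasurable).2 integrable_log_sq_standardComplexGaussian
  rw [← hζ.map_eq] at h
  exact h.comp_of_map hζ.aemeasurable

theorem aemeasurable_normalizedGaf (ha_law : ∀ n, HasLaw (a n) standardComplexGaussian P)
    {X : Type*} [MeasurableSpace X] (ν : Measure X) [SFinite ν] {f : X → S2} (hf : Measurable f) :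
    AEMeasurable (fun q : Ω × X => normalizedGaf N (fun n => a n q.1) (f q.2)) (P.prod ν) := by
  refine Finset.aemeasurable_fun_sum _ fun n _ => ?_
  have h1 : AEMeasurable (fun q : Ω × X => a n q.1) (P.prod ν) :=
    (ha_law n).aemeasurable.comp_quasiMeasurePreserving Measure.quasiMeasurePreserving_fst
  exact h1.mul ((measurable_gafCoeff N n).comp (hf.comp measurable_snd)).aemeasurable

theorem aemeasurable_centeredLog (ha_law : ∀ n, HasLaw (a n) standardComplexGaussian P)
    {X : Type*} [MeasurableSpace X] (ν : Measure X) [SFinite ν] {f : X → S2} (hf : Measurable f) :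
    AEMeasurable (fun q : Ω × X => centeredLog a q.1 (f q.2)) (P.prod ν) :=
  ((((aemeasurable_normalizedGaf ha_law ν hf).norm.pow_const 2)).log).add_const _

theorem IsEigenfunction.linearStatistic_ae_eq {lam : ℝ} {Y : S2 → ℝ} (hY : IsEigenfunction lam Y)
    (ha_law : ∀ n, HasLaw (a n) standardComplexGaussian P) :
    (fun ω => linearStatistic N Y (fun n => a n ω)) =ᵐ[P]
      fun ω => N * ∫ x, Y x ∂vol - lam * ∫ x, Y x * centeredLog a ω x ∂vol :=
  (ae_ne_zero_of_hasLaw (ha_law 0)).mono fun _ hω => hY.linearStatistic_eq (gaf_ne_zero hω) _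

variable [IsProbabilityMeasure P]

theorem hasLaw_normalizedGaf (ha_law : ∀ n, HasLaw (a n) standardComplexGaussian P)
    (ha_indep : iIndepFun a P) (x : S2) :
    HasLaw (fun ω => normalizedGaf N (fun n => a n ω) x) standardComplexGaussian P :=
  hasLaw_linearCombination ha_law ha_indep _ (sum_norm_gafCoeff_sq N x)

theorem memLp_centeredLog (ha_law : ∀ n, HasLaw (a n) standardComplexGaussian P)
    (ha_indep : iIndepFun a P) (x : S2) : MemLp (fun ω => centeredLog a ω x) 2 P :=
  (memLp_log_of_hasLaw (hasLaw_normalizedGaf ha_law ha_indep x)).add (memLp_const logCenter)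

theorem integral_centeredLog_sq (ha_law : ∀ n, HasLaw (a n) standardComplexGaussian P)
    (ha_indep : iIndepFun a P) (x : S2) :
    ∫ ω, centeredLog a ω x ^ 2 ∂P = logSecondMoment := by
  have h := hasLaw_normalizedGaf ha_law ha_indep x
  have hm : Measurable fun z : ℂ => (Real.log (‖z‖ ^ 2) + logCenter) ^ 2 := by fun_prop
  rw [logSecondMoment, ← h.map_eq, integral_map h.aemeasurable hm.aestronglyMeasurable]
  rfl

theorem integral_exp_normalizedGaf (ha_law : ∀ n, HasLaw (a n) standardComplexGaussian P)
    (ha_indep : iIndepFun a P) (x : S2) (t : ℝ) (ht : 0 ≤ t) :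
    ∫ ω, Real.exp (-t * ‖normalizedGaf N (fun n => a n ω) x‖ ^ 2) ∂P = (1 + t)⁻¹ := by
  have hu := sum_norm_gafCoeff_sq N x
  have hr : ‖∑ n, starRingEnd ℂ (gafCoeff N x n) * gafCoeff N x n‖ ^ 2 = 1 := by
    simp_rw [Complex.conj_mul', ← Complex.ofReal_pow, ← Complex.ofReal_sum, hu]
    simp
  have := integral_exp_norm_sq_mul_exp_norm_sq ha_law ha_indep hu hu hr le_rfl ht le_rfl
  simpa [normalizedGaf] using this

theorem abs_integral_centeredLog_mul_le (ha_law : ∀ n, HasLaw (a n) standardComplexGaussian P)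
    (ha_indep : iIndepFun a P) {x y : S2} (hx : x ≠ northPole) (hy : y ≠ northPole) :
    |∫ ω, centeredLog a ω x * centeredLog a ω y ∂P| ≤
      ((1 + inner ℝ (x : E3) y) / 2) ^ N * (Real.pi ^ 2 / 6) := by
  have hlx := hasLaw_normalizedGaf ha_law ha_indep x
  have hly := hasLaw_normalizedGaf ha_law ha_indep y
  have hr := inner_pow_mem_unitInterval N x y
  refine abs_integral_log_mul_log_le (hlx.aemeasurable.norm.pow_const 2)
    (hly.aemeasurable.norm.pow_const 2)
    ((ae_ne_zero_of_hasLaw hlx).mono fun ω h => by positivity)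
    ((ae_ne_zero_of_hasLaw hly).mono fun ω h => by positivity)
    (memLp_log_of_hasLaw hlx) (memLp_log_of_hasLaw hly) hr.1 hr.2
    (integral_exp_normalizedGaf ha_law ha_indep x) (integral_exp_normalizedGaf ha_law ha_indep y)
    fun t u ht hu => ?_
  exact integral_exp_norm_sq_mul_exp_norm_sq ha_law ha_indep (sum_norm_gafCoeff_sq N x)
    (sum_norm_gafCoeff_sq N y) (norm_sum_conj_gafCoeff_sq N hx hy) hr.2 ht hu

/-- The second moment is the same at every point of the sphere, so integrability on the product
follows from Tonelli. The map `f` allows either coordinate of `S2 × S2`. -/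
theorem integrable_centeredLog_sq (ha_law : ∀ n, HasLaw (a n) standardComplexGaussian P)
    (ha_indep : iIndepFun a P) {X : Type*} [MeasurableSpace X] (ν : Measure X) [IsFiniteMeasure ν]
    {f : X → S2} (hf : Measurable f) :
    Integrable (fun q : Ω × X => centeredLog a q.1 (f q.2) ^ 2) (P.prod ν) := by
  have hm : AEStronglyMeasurable (fun q : Ω × X => centeredLog a q.1 (f q.2) ^ 2) (P.prod ν) :=
    ((aemeasurable_centeredLog ha_law ν hf).pow_const 2).aestronglyMeasurable
  refine (integrable_prod_iff' hm).2 ⟨Filter.Eventually.of_forall fun x => ?_, ?_⟩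
  · exact (memLp_centeredLog ha_law ha_indep (f x)).integrable_sq
  · have e : ∀ x, ∫ ω, ‖centeredLog a ω (f x) ^ 2‖ ∂P = logSecondMoment := fun x => by
      rw [← integral_centeredLog_sq ha_law ha_indep (f x)]
      exact integral_congr_ae (Filter.Eventually.of_forall fun ω =>
        Real.norm_of_nonneg (sq_nonneg (centeredLog a ω (f x))))
    exact (integrable_congr (Filter.Eventually.of_forall e)).2 (integrable_const logSecondMoment)

/-- This is the Schur test: the covariance kernel is dominated by `r π² / 6`, where `r` has integral
`1 / (N + 1)` in either variable. -/
theorem integral_sq_integral_mul_centeredLog_le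
    (ha_law : ∀ n, HasLaw (a n) standardComplexGaussian P) (ha_indep : iIndepFun a P)
    {Y : S2 → ℝ} (hY : Continuous Y) :
    ∫ ω, (∫ x, Y x * centeredLog a ω x ∂vol) ^ 2 ∂P ≤
      Real.pi ^ 2 / 6 / (N + 1) * ∫ x, Y x * Y x ∂vol := by
  obtain ⟨M, hM⟩ := isCompact_univ.exists_bound_of_continuousOn hY.continuousOn
  have hM0 : 0 ≤ M := (norm_nonneg _).trans (hM northPole trivial)
  have hint : Integrable (Function.uncurry fun (ω : Ω) (p : S2 × S2) =>
      (Y p.1 * centeredLog a ω p.1) * (Y p.2 * centeredLog a ω p.2)) (P.prod (vol.prod vol)) := by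
    have m1 := aemeasurable_centeredLog ha_law (vol.prod vol) measurable_fst
    have m2 := aemeasurable_centeredLog ha_law (vol.prod vol) measurable_snd
    have y1 : Measurable fun q : Ω × S2 × S2 => Y q.2.1 :=
      hY.measurable.comp measurable_snd.fst
    have y2 : Measurable fun q : Ω × S2 × S2 => Y q.2.2 :=
      hY.measurable.comp measurable_snd.snd
    refine (((integrable_centeredLog_sq ha_law ha_indep (vol.prod vol) measurable_fst).add
      (integrable_centeredLog_sq ha_law ha_indep (vol.prod vol) measurable_snd)).const_mul
        (M ^ 2)).mono' ((y1.aemeasurable.mul m1).mul (y2.aemeasurable.mul m2)).aestronglyMeasurable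
      (Filter.Eventually.of_forall fun q => ?_)
    simp only [Function.uncurry, Pi.add_apply, norm_mul, Real.norm_eq_abs]
    have b1 := hM q.2.1 trivial
    have b2 := hM q.2.2 trivial
    rw [Real.norm_eq_abs] at b1 b2
    rw [← sq_abs (centeredLog a q.1 q.2.1), ← sq_abs (centeredLog a q.1 q.2.2)]
    generalize hu : |centeredLog a q.1 q.2.1| = u
    generalize hv : |centeredLog a q.1 q.2.2| = v
    have hu0 : 0 ≤ u := hu ▸ abs_nonneg _
    have hv0 : 0 ≤ v := hv ▸ abs_nonneg _
    calc |Y q.2.1| * u * (|Y q.2.2| * v) ≤ M * u * (M * v) := by gcongr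
      _ = M ^ 2 * (u * v) := by ring
      _ ≤ M ^ 2 * (u ^ 2 + v ^ 2) := by
        refine mul_le_mul_of_nonneg_left ?_ (sq_nonneg M)
        nlinarith [sq_nonneg (u - v)]
  have hK : Continuous fun p : S2 × S2 => ((1 + inner ℝ (p.1 : E3) p.2) / 2) ^ N := by fun_prop
  have hfin : ∀ {g : S2 × S2 → ℝ}, Continuous g → Integrable g (vol.prod vol) := by
    intro g hg
    obtain ⟨C, hC⟩ := isCompact_univ.exists_bound_of_continuousOn hg.continuousOn
    exact Integrable.of_bound hg.aestronglyMeasurable C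
      (Filter.Eventually.of_forall fun x => hC x trivial)
  have hae : ∀ᵐ p : S2 × S2 ∂(vol.prod vol), p.1 ≠ northPole ∧ p.2 ≠ northPole := by
    have h := ae_ne_of_finite (Set.finite_singleton northPole)
    exact (Measure.quasiMeasurePreserving_fst.ae h).and (Measure.quasiMeasurePreserving_snd.ae h)
  have c1 : Continuous fun p : S2 × S2 =>
      Y p.1 * Y p.1 * ((1 + inner ℝ (p.1 : E3) p.2) / 2) ^ N := by fun_prop
  have c2 : Continuous fun p : S2 × S2 =>
      Y p.2 * Y p.2 * ((1 + inner ℝ (p.1 : E3) p.2) / 2) ^ N := by fun_prop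
  have i1 : ∫ p : S2 × S2, Y p.1 * Y p.1 * ((1 + inner ℝ (p.1 : E3) p.2) / 2) ^ N
      ∂(vol.prod vol) = 1 / (N + 1) * ∫ x, Y x * Y x ∂vol := by
    rw [integral_prod _ (hfin c1), ← integral_const_mul]
    refine integral_congr_ae (Filter.Eventually.of_forall fun x => ?_)
    simp only
    rw [integral_const_mul, ← integral_inner_pow N x, mul_comm]
    simp_rw [real_inner_comm]
  have i2 : ∫ p : S2 × S2, Y p.2 * Y p.2 * ((1 + inner ℝ (p.1 : E3) p.2) / 2) ^ N
      ∂(vol.prod vol) = 1 / (N + 1) * ∫ x, Y x * Y x ∂vol := by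
    rw [integral_prod_symm _ (hfin c2), ← integral_const_mul]
    refine integral_congr_ae (Filter.Eventually.of_forall fun x => ?_)
    simp only
    rw [integral_const_mul, ← integral_inner_pow N x, mul_comm]
  calc ∫ ω, (∫ x, Y x * centeredLog a ω x ∂vol) ^ 2 ∂P
      = ∫ ω, ∫ p : S2 × S2, (Y p.1 * centeredLog a ω p.1) * (Y p.2 * centeredLog a ω p.2)
          ∂(vol.prod vol) ∂P := by
        refine integral_congr_ae (Filter.Eventually.of_forall fun ω => ?_)
        simp only
        rw [integral_prod_mul (fun x => Y x * centeredLog a ω x)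
          (fun x => Y x * centeredLog a ω x), sq]
    _ = ∫ p : S2 × S2, ∫ ω, (Y p.1 * centeredLog a ω p.1) * (Y p.2 * centeredLog a ω p.2) ∂P
          ∂(vol.prod vol) := integral_integral_swap hint
    -- The arithmetic-geometric inequality `|Y(x) Y(y)| ≤ (Y(x)² + Y(y)²) / 2` splits the integral
    -- into two equal halves.
    _ ≤ ∫ p : S2 × S2, (Real.pi ^ 2 / 6 / 2 *
          (Y p.1 * Y p.1 * ((1 + inner ℝ (p.1 : E3) p.2) / 2) ^ N) + Real.pi ^ 2 / 6 / 2 *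
          (Y p.2 * Y p.2 * ((1 + inner ℝ (p.1 : E3) p.2) / 2) ^ N)) ∂(vol.prod vol) := by
        refine integral_mono_ae hint.integral_prod_right
          (((hfin c1).const_mul _).add ((hfin c2).const_mul _)) (hae.mono fun p hp => ?_)
        have hb := abs_integral_centeredLog_mul_le ha_law ha_indep hp.1 hp.2
        have e : ∫ ω, (Y p.1 * centeredLog a ω p.1) * (Y p.2 * centeredLog a ω p.2) ∂P =
            (Y p.1 * Y p.2) * ∫ ω, centeredLog a ω p.1 * centeredLog a ω p.2 ∂P := by
          rw [← integral_const_mul]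
          congr 1
          ext ω
          ring
        simp only
        rw [e]
        have hr := (inner_pow_mem_unitInterval N p.1 p.2).1
        refine (le_abs_self _).trans ?_
        rw [abs_mul, abs_mul]
        generalize ((1 + inner ℝ (p.1 : E3) p.2) / 2) ^ N = r at hb hr ⊢
        refine (mul_le_mul_of_nonneg_left hb (by positivity)).trans ?_
        rw [← abs_mul_abs_self (Y p.1), ← abs_mul_abs_self (Y p.2)]
        have hk : 0 ≤ r * (Real.pi ^ 2 / 6) := by positivity
        nlinarith [mul_nonneg hk (sq_nonneg (|Y p.1| - |Y p.2|))]
    _ = Real.pi ^ 2 / 6 / (N + 1) * ∫ x, Y x * Y x ∂vol := by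
        rw [integral_add ((hfin c1).const_mul _) ((hfin c2).const_mul _), integral_const_mul,
          integral_const_mul, i1, i2]
        ring

/-- There are always exactly `N` zeros and `Y` is bounded, so the statistic is bounded.
Measurability comes from the almost sure integral formula and does not require the roots to depend
measurably on the coefficients. -/
theorem IsEigenfunction.memLp_linearStatistic {lam : ℝ} {Y : S2 → ℝ}
    (hY : IsEigenfunction lam Y) (ha_law : ∀ n, HasLaw (a n) standardComplexGaussian P) :
    MemLp (fun ω => linearStatistic N Y (fun n => a n ω)) 2 P := by
  obtain ⟨M, hM⟩ := isCompact_univ.exists_bound_of_continuousOn hY.continuous.continuousOn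
  have hmeas : AEStronglyMeasurable (fun ω => linearStatistic N Y (fun n => a n ω)) P := by
    refine AEStronglyMeasurable.congr ?_ (hY.linearStatistic_ae_eq ha_law).symm
    have h1 := aemeasurable_centeredLog ha_law vol measurable_id
    have h2 : Measurable fun q : Ω × S2 => Y q.2 := hY.continuous.measurable.comp measurable_snd
    have h3 := ((h2.aemeasurable.mul h1).aestronglyMeasurable).integral_prod_right'
    exact aestronglyMeasurable_const.sub (h3.const_mul lam)
  refine MemLp.of_bound hmeas (N * M) (Filter.Eventually.of_forall fun ω => ?_)
  have hs : ∀ s : Multiset S2, ‖(s.map Y).sum‖ ≤ s.card * M := by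
    intro s
    induction s using Multiset.induction with
    | empty => simp
    | cons y s ih =>
      rw [Multiset.map_cons, Multiset.sum_cons, Multiset.card_cons]
      push_cast
      linarith [norm_add_le (Y y) (s.map Y).sum, hM y trivial]
  have := hs (zerosOnSphere N fun n => a n ω)
  rwa [card_zerosOnSphere] at this

/-- The variance of the linear statistic of a single eigenfunction. -/
theorem IsEigenfunction.variance_linearStatistic_le {lam : ℝ} {Y : S2 → ℝ}
    (hY : IsEigenfunction lam Y) (ha_law : ∀ n, HasLaw (a n) standardComplexGaussian P)
    (ha_indep : iIndepFun a P) :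
    variance (fun ω => linearStatistic N Y (fun n => a n ω)) P ≤
      lam ^ 2 * (Real.pi ^ 2 / 6 / (N + 1) * ∫ x, Y x * Y x ∂vol) := by
  have hL := hY.memLp_linearStatistic ha_law
  -- The second moment about any constant bounds the variance, so `N ∫ Y` need not be identified as
  -- the mean.
  rw [← variance_sub_const hL.aestronglyMeasurable (N * ∫ x, Y x ∂vol)]
  refine (variance_le_expectation_sq
    (hL.aestronglyMeasurable.sub aestronglyMeasurable_const)).trans ?_
  refine le_trans (le_of_eq ?_) (mul_le_mul_of_nonneg_left
    (integral_sq_integral_mul_centeredLog_le ha_law ha_indep hY.continuous) (sq_nonneg lam))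
  refine Eq.trans ?_ (integral_const_mul (lam ^ 2) _)
  refine integral_congr_ae ((hY.linearStatistic_ae_eq ha_law).mono fun ω hω => ?_)
  simp only [Pi.pow_apply, Pi.sub_apply] at hω ⊢
  rw [hω]
  ring

end SphericalGAF

end

/-! ### Summation over the orthonormal family -/

theorem mainTheorem10 {Ω : Type*} [MeasurableSpace Ω] (P : Measure Ω) [IsProbabilityMeasure P]
    (N : ℕ) (hN : 1 ≤ N) (a : Fin (N + 1) → Ω → ℂ)
    (ha_law : ∀ n, HasLaw (a n) SphericalGAF.standardComplexGaussian P)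
    (ha_indep : iIndepFun a P)
    (l : ℕ) (Y : Fin (2 * l + 1) → SphericalGAF.S2 → ℝ)
    (hY_eig : ∀ m, SphericalGAF.IsEigenfunction ((l : ℝ) * ((l : ℝ) + 1)) (Y m))
    (hY_orth : SphericalGAF.IsOrthonormal Y) :
    (∀ m, MemLp (fun ω => SphericalGAF.linearStatistic N (Y m) (fun n => a n ω)) 2 P) ∧
    ∑ m, variance (fun ω => SphericalGAF.linearStatistic N (Y m) (fun n => a n ω)) P ≤
      ((2 * (l : ℝ) + 1) * ((l : ℝ) * ((l : ℝ) + 1)) ^ 2 / (N : ℝ)) * (Real.pi ^ 2 / 6) := by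
  refine ⟨fun m => (hY_eig m).memLp_linearStatistic ha_law, ?_⟩
  have hN0 : (0 : ℝ) < N := by exact_mod_cast hN
  have h : ∀ m, variance (fun ω => SphericalGAF.linearStatistic N (Y m) (fun n => a n ω)) P ≤
      ((l : ℝ) * ((l : ℝ) + 1)) ^ 2 * (Real.pi ^ 2 / 6 / N) := by
    intro m
    refine ((hY_eig m).variance_linearStatistic_le ha_law ha_indep).trans ?_
    rw [hY_orth m m, if_pos rfl, mul_one]
    -- The single-eigenfunction bound has `N + 1` in the denominator; it is weakened to `N`.
    gcongr
    linarith
  refine (Finset.sum_le_sum fun m _ => h m).trans (le_of_eq ?_)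
  rw [Finset.sum_const, Finset.card_univ, Fintype.card_fin, nsmul_eq_mul]
  push_cast
  ring
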